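/- **Setting.** Let $D\ge 0$ (number of space dimensions) and $n_0,n_1,\dots,n_D\ge 1$ be integers, $h_d=1/n_d$, $X=[0,1]^D$, and let $\rho_0,\rho_1$ be nonzero finite nonnegative Borel measures on $X$. Let $\mathcal G^c=\prod_{d=0}^D\{0,1,\dots,n_d\}$ be the centered grid and, for $0\le d\le D$, let $\mathcal G^s_d$ be the staggered grid obtained from $\mathcal G^c$ by replacing the $d$-th factor by $\{\tfrac12,\tfrac32,\dots,n_d-\tfrac12\}$. All spaces below carry the standard Euclidean inner product; ${}^*$ denotes the adjoint, and $\mathbf e_0,\dots,\mathbf e_D$ is the standard basis of $\mathbb R^{D+1}$. * $\mathbf c\in\mathbb R^{\mathcal G^c}$ is given by $\mathbf c_{\mathbf i}=\rho_0(X_{i_1,\dots,i_D})/\big(\sum_j\rho_0(X_j)h_X\big)$ if $i_0=0$, by $\mathbf c_{\mathbf i}=-\rho_1(X_{i_1,\dots,i_D})/\big(\sum_j\rho_1(X_j)h_X\big)$ if $i_0=n_0$, and by $\mathbf c_{\mathbf i}=0$ otherwise. Here $X_{i_1,\dots,i_D}=\{y\in X: |i_dh_d-y_d|\le h_d/2,\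 d=1,\dots,D\}$, $h_X=h_1\cdots h_D$, and $j$ runs over $\prod_{d=1}^D\{0,\dots,n_d\}$. * $\mathcal A\varphi=(\mathcal A_0\varphi;\dots;\mathcal A_D\varphi)$ with $(\mathcal A_d\varphi)_{\mathbf i}=\frac1{h_d}\big(\varphi_{\mathbf i+\mathbf e_d/2}-\varphi_{\mathbf i-\mathbf e_d/2}\big)$ for $\mathbf i\in\mathcal G^s_d$; $\operatorname{rge}(\mathcal A^*)$ is the range of $\mathcal A^*$. * For $\mathbf q=(\mathbf q_0;\dots;\mathbf q_D)\in\mathbb R^{\mathcal G^s_0}\times\dots\times\mathbb R^{\mathcal G^s_D}$, $\mathcal F\mathbf q=(\mathbf q_0;\mathcal F^1_1\mathbf q_1;\dots;\mathcal F^1_4\mathbf q_1;\dots;\mathcal F^D_1\mathbf q_D;\dots;\mathcal F^D_4\mathbf q_D)$, where for $\mathbf i\in\mathcal G^s_0$ the numbers $(\mathcal F^d_v\mathbf q_d)_{\mathbf i}$, $v=1,2,3,4$, are the entries of $\mathbf q_d$ at $\mathbf i-\frac{\mathbf e_0+\mathbf e_d}2$, $\mathbf i-\frac{\mathbf e_0-\mathbf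 e_d}2$, $\mathbf i+\frac{\mathbf e_0-\mathbf e_d}2$, $\mathbf i+\frac{\mathbf e_0+\mathbf e_d}2$, an entry being replaced by $0$ when the point is not in $\mathcal G^s_d$. * $\mathcal B(\mathbf x_0;\mathbf x_1;\dots;\mathbf x_{4D})=(-\mathbf x_0;\frac{\sqrt2}2\mathbf x_1;\dots;\frac{\sqrt2}2\mathbf x_{4D};\mathbf x_0)$ for $\mathbf x_l\in\mathbb R^{\mathcal G^s_0}$, and $\mathbf d=(\mathbf 1;\mathbf 0;\dots;\mathbf 0;\mathbf 1)\in(\mathbb R^{\mathcal G_0^s})^{4D+2}$. * $\mathbb Q\subset(\mathbb R^{\mathcal G_0^s})^{4D+2}$ is the set of $(\beta_1;\dots;\beta_{4D+2})$ such that for every $\mathbf i\in\mathcal G^s_0$, $(\beta_1)_{\mathbf i}\ge\|((\beta_2)_{\mathbf i},\dots,(\beta_{4D+2})_{\mathbf i})\|$; $\delta_{\mathbb Q}$ is $0$ on $\mathbb Q$ and $+\infty$ elsewhere. Consider the second-order cone program $\min_{\varphi,\mathbf q,\mathbf z}\langle\mathbf c,\varphi\rangle+\delta_{\mathbb Q}(\mathbf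 z)$ subject to $\mathcal A\varphi-\mathbf q=0$, $\mathbf z-\mathcal{BF}\mathbf q=\mathbf d$. Its KKT system is $$\text{(26)}\qquad \mathcal A\varphi=\mathbf q,\quad \mathbf z=\mathcal{BF}\mathbf q+\mathbf d,\quad \mathcal A^*\boldsymbol\alpha+\mathbf c=0,\quad \boldsymbol\alpha+\mathcal F^*\mathcal B^*\boldsymbol\beta=0,\quad \mathbf z\in\mathbb Q,\ \boldsymbol\beta\in\mathbb Q,\ \langle\mathbf z,\boldsymbol\beta\rangle=0 .$$ The KKT system (29) of the range-restricted program (the same program with the additional constraint $\varphi\in\operatorname{rge}(\mathcal A^*)$) is (26) together with $\varphi\in\operatorname{rge}(\mathcal A^*)$. For $\sigma>0$ the augmented Lagrangian function is $$\mathcal L_\sigma(\varphi,\mathbf z,\mathbf q;\boldsymbol\alpha,\boldsymbol\beta)=\langle\mathbf c,\varphi\rangle+\delta_{\mathbb Q}(\mathbf z)+\langle\mathcal A\varphi-\mathbf q,\boldsymbol\alpha\rangle+\langle\mathbf z-\mathcal{BF}\mathbf q-\mathbf d,\boldsymbol\beta\rangle+\tfrac\sigma2\|\mathcal A\varphi-\mathbf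 q\|^2+\tfrac\sigma2\|\mathbf z-\mathcal{BF}\mathbf q-\mathbf d\|^2 .$$ **Algorithm 1.** Given $\sigma>0$, $\tau\in(0,2)$ and an initial point $(\mathbf q^{(0)},\boldsymbol\alpha^{(0)},\boldsymbol\beta^{(0)})$ with $\boldsymbol\beta^{(0)}\in\mathbb Q$, repeat for $k=0,1,\dots$: 1. $(\varphi^{(k+1)},\mathbf z^{(k+1)})\in\arg\min_{\varphi,\mathbf z}\{\mathcal L_\sigma(\varphi,\mathbf z,\mathbf q^{(k)};\boldsymbol\alpha^{(k)},\boldsymbol\beta^{(k)}) : \varphi\in\operatorname{rge}(\mathcal A^*)\}$; 2. $\mathbf q^{(k+1)}\in\arg\min_{\mathbf q}\mathcal L_\sigma(\varphi^{(k+1)},\mathbf z^{(k+1)},\mathbf q;\boldsymbol\alpha^{(k)},\boldsymbol\beta^{(k)})$; 3. $\boldsymbol\alpha^{(k+1)}=\boldsymbol\alpha^{(k)}+\tau\sigma(\mathcal A\varphi^{(k+1)}-\mathbf q^{(k+1)})$ and $\boldsymbol\beta^{(k+1)}=\boldsymbol\beta^{(k)}+\tau\sigma(\mathbf z^{(k+1)}-\mathcal{BF}\mathbf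 q^{(k+1)}-\mathbf d)$. **Theorem 4.1.** For every $\sigma>0$, every $\tau\in(0,2)$ and every such initial point, Algorithm 1 can be carried out, i.e. it generates an infinite sequence, and every sequence $\{(\varphi^{(k)},\mathbf z^{(k)},\mathbf q^{(k)},\boldsymbol\alpha^{(k)},\boldsymbol\beta^{(k)})\}$ generated by it converges to a solution $(\varphi,\mathbf z,\mathbf q,\boldsymbol\alpha,\boldsymbol\beta)$ of the KKT system (29), which is therefore also a solution of (26). -/

import Mathlib

open Filter Topology MeasureTheory

namespace DiscreteDOT

/-! ### Grids

The time-space domain `[0,1] × [0,1]^D` is cut into `n d` segments of length `h_d = 1 / n d` along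
the axis `d`, where `d = 0` is time and `d.succ`, for `d : Fin D`, are the spatial axes. -/

/-- The centered grid: multi-indices `(i_0, …, i_D)` of integers with `0 ≤ i_d ≤ n d`. -/
abbrev CGrid {D : ℕ} (n : Fin (D + 1) → ℕ) : Type := (e : Fin (D + 1)) → Fin (n e + 1)

/-- The staggered grid in the direction `d`. Its points have a half-integer `d`-th index in
`{1/2, …, n d - 1/2}` and integer indices in the other directions. The point `i + e_d / 2` is
represented by its lower neighbour `i` in the centered grid, which satisfies `i_d ≤ n d - 1`. -/
abbrev SGrid {D : ℕ} (n : Fin (D + 1) → ℕ) (d : Fin (D + 1)) : Type :=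
  {i : CGrid n // (i d : ℕ) < n d}

/-- The multi-index `i + e_d`, for `i_d < n d`. -/
def up {D : ℕ} {n : Fin (D + 1) → ℕ} (i : CGrid n) (d : Fin (D + 1)) (h : (i d : ℕ) < n d) :
    CGrid n :=
  Function.update i d ⟨(i d : ℕ) + 1, by omega⟩

/-- The multi-index `i - e_d` (used only for `1 ≤ i_d`). -/
def down {D : ℕ} {n : Fin (D + 1) → ℕ} (i : CGrid n) (d : Fin (D + 1)) : CGrid n :=
  Function.update i d ⟨(i d : ℕ) - 1, by omega⟩

theorem down_lt {D : ℕ} {n : Fin (D + 1) → ℕ} (i : CGrid n) (d : Fin (D + 1))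
    (h : 0 < (i d : ℕ)) : ((down i d) d : ℕ) < n d := by
  have := (i d).isLt
  simp only [down, Function.update_self]
  omega

theorem up_apply_of_ne {D : ℕ} {n : Fin (D + 1) → ℕ} (i : CGrid n) (d e : Fin (D + 1))
    (h : (i d : ℕ) < n d) (hne : e ≠ d) : (up i d h) e = i e := by
  simp [up, Function.update_of_ne hne]

/-! ### Spaces of grid functions, all with the standard Euclidean inner product -/

/-- Grid functions `φ` on the centered grid. -/
abbrev CSpace {D : ℕ} (n : Fin (D + 1) → ℕ) : Type := EuclideanSpace ℝ (CGrid n)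

/-- Vectors `q = (q_0; …; q_D)`, where `q_d` is a function on the staggered grid of direction `d`;
the entry `(q_d)_i` is `q ⟨d, i⟩`. -/
abbrev SSpace {D : ℕ} (n : Fin (D + 1) → ℕ) : Type :=
  EuclideanSpace ℝ (Σ d : Fin (D + 1), SGrid n d)

/-- Labels of the `4 D + 1` blocks of `F q`: the block `0`, then the blocks `(d, v)` with
`d = 1, …, D` and `v = 1, …, 4`. -/
abbrev FLabel (D : ℕ) : Type := Unit ⊕ (Fin D × Fin 4)

/-- Labels of the `4 D + 2` coordinates of the second-order cones: the distinguished first one,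
then the labels `(d, v)`, then the last one. -/
abbrev KLabel (D : ℕ) : Type := Unit ⊕ ((Fin D × Fin 4) ⊕ Unit)

/-- The space of `F q`: `4 D + 1` functions on the staggered grid in time. -/
abbrev FSpace {D : ℕ} (n : Fin (D + 1) → ℕ) : Type := EuclideanSpace ℝ (FLabel D × SGrid n 0)

/-- The space of `z` and `β`: `4 D + 2` functions on the staggered grid in time. -/
abbrev KSpace {D : ℕ} (n : Fin (D + 1) → ℕ) : Type := EuclideanSpace ℝ (KLabel D × SGrid n 0)

/-! ### The linear operators -/

/-- The discrete gradient `A φ = (A_0 φ; …; A_D φ)`, where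
`(A_d φ)_i = (φ_{i + e_d/2} - φ_{i - e_d/2}) / h_d` and `1 / h_d = n d`. -/
noncomputable def gradOp {D : ℕ} (n : Fin (D + 1) → ℕ) : CSpace n →ₗ[ℝ] SSpace n where
  toFun φ := WithLp.toLp 2 fun p =>
    (n p.1 : ℝ) * (φ (up p.2.1 p.1 p.2.2) - φ p.2.1)
  map_add' φ ψ := by
    ext p
    simp only [PiLp.add_apply]
    ring
  map_smul' a φ := by
    ext p
    simp only [PiLp.smul_apply, smul_eq_mul, RingHom.id_apply]
    ring

/-- The entry `(F_v^d q_d)_i` for a point `i` of the staggered grid in time. In the order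
`v = 1, 2, 3, 4` it is the entry of `q_d` at `i - (e_0 + e_d)/2`, `i - (e_0 - e_d)/2`,
`i + (e_0 - e_d)/2`, `i + (e_0 + e_d)/2`, and `0` when that point is outside the grid. -/
noncomputable def shiftEntry {D : ℕ} {n : Fin (D + 1) → ℕ} (q : SSpace n) (d : Fin D) (v : Fin 4)
    (i : SGrid n 0) : ℝ :=
  match v with
  | 0 => if h : 0 < (i.1 d.succ : ℕ) then
      q ⟨d.succ, down i.1 d.succ, down_lt i.1 d.succ h⟩ else 0
  | 1 => if h : (i.1 d.succ : ℕ) < n d.succ then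
      q ⟨d.succ, i.1, h⟩ else 0
  | 2 => if h : 0 < (i.1 d.succ : ℕ) then
      q ⟨d.succ, down (up i.1 0 i.2) d.succ, down_lt _ d.succ
        (by rw [up_apply_of_ne _ _ _ _ (Fin.succ_ne_zero d)]; exact h)⟩ else 0
  | 3 => if h : (i.1 d.succ : ℕ) < n d.succ then
      q ⟨d.succ, up i.1 0 i.2,
        by rw [up_apply_of_ne _ _ _ _ (Fin.succ_ne_zero d)]; exact h⟩ else 0

theorem shiftEntry_add {D : ℕ} {n : Fin (D + 1) → ℕ} (q r : SSpace n) (d : Fin D) (v : Fin 4)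
    (i : SGrid n 0) : shiftEntry (q + r) d v i = shiftEntry q d v i + shiftEntry r d v i := by
  fin_cases v <;> simp only [shiftEntry, PiLp.add_apply] <;> split_ifs <;> simp

theorem shiftEntry_smul {D : ℕ} {n : Fin (D + 1) → ℕ} (a : ℝ) (q : SSpace n) (d : Fin D)
    (v : Fin 4) (i : SGrid n 0) : shiftEntry (a • q) d v i = a * shiftEntry q d v i := by
  fin_cases v <;> simp only [shiftEntry, PiLp.smul_apply, smul_eq_mul] <;> split_ifs <;> simp

/-- The decoupling operator `F q = (q_0; F_1^1 q_1; …; F_4^1 q_1; …; F_1^D q_D; …; F_4^D q_D)`. -/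
noncomputable def decoupleOp {D : ℕ} (n : Fin (D + 1) → ℕ) : SSpace n →ₗ[ℝ] FSpace n where
  toFun q := WithLp.toLp 2 fun p =>
    match p.1 with
    | Sum.inl _ => q ⟨0, p.2⟩
    | Sum.inr (d, v) => shiftEntry q d v p.2
  map_add' q r := by
    ext ⟨l, i⟩
    rcases l with _ | ⟨d, v⟩ <;> simp [shiftEntry_add]
  map_smul' a q := by
    ext ⟨l, i⟩
    rcases l with _ | ⟨d, v⟩ <;> simp [shiftEntry_smul]

/-- The operator `B (x_0; x_1; …; x_{4D}) = (-x_0; (√2/2) x_1; …; (√2/2) x_{4D}; x_0)`. -/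
noncomputable def coneOp {D : ℕ} (n : Fin (D + 1) → ℕ) : FSpace n →ₗ[ℝ] KSpace n where
  toFun x := WithLp.toLp 2 fun p =>
    match p.1 with
    | Sum.inl _ => -x (Sum.inl (), p.2)
    | Sum.inr (Sum.inl l) => Real.sqrt 2 / 2 * x (Sum.inr l, p.2)
    | Sum.inr (Sum.inr _) => x (Sum.inl (), p.2)
  map_add' x y := by
    ext ⟨l, i⟩
    rcases l with _ | _ | _ <;> simp <;> ring
  map_smul' a x := by
    ext ⟨l, i⟩
    rcases l with _ | _ | _ <;> simp
    ring

/-- The composition `B F`. -/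
noncomputable def BF {D : ℕ} (n : Fin (D + 1) → ℕ) : SSpace n →ₗ[ℝ] KSpace n :=
  coneOp n ∘ₗ decoupleOp n

/-- The vector `d = (1; 0; …; 0; 1)`. -/
noncomputable def shiftVec {D : ℕ} (n : Fin (D + 1) → ℕ) : KSpace n :=
  WithLp.toLp 2 fun p =>
    match p.1 with
    | Sum.inl _ => 1
    | Sum.inr (Sum.inl _) => 0
    | Sum.inr (Sum.inr _) => 1

/-! ### The cone -/

/-- The second-order cone `{y = (y_0; ȳ) | ‖ȳ‖ ≤ y_0}`, with the Euclidean norm of `ȳ`. -/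
def soc (κ : Type*) [Fintype κ] : Set (EuclideanSpace ℝ (Unit ⊕ κ)) :=
  {y | ‖(WithLp.toLp 2 fun k => y (Sum.inr k) : EuclideanSpace ℝ κ)‖ ≤ y (Sum.inl ())}

/-- The product cone `Q`: at each point `i` of the staggered grid in time, the vector of the
`4 D + 2` entries at `i` lies in the second-order cone. -/
def coneQ {D : ℕ} (n : Fin (D + 1) → ℕ) : Set (KSpace n) :=
  {z | ∀ i : SGrid n 0, WithLp.toLp 2 (fun l => z (l, i)) ∈ soc ((Fin D × Fin 4) ⊕ Unit)}

/-- The indicator function `δ_Q` of convex analysis. -/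
noncomputable def indQ {D : ℕ} (n : Fin (D + 1) → ℕ) (z : KSpace n) : EReal :=
  open Classical in if z ∈ coneQ n then 0 else ⊤

/-! ### The data of the transport problem -/

/-- The spatial domain `X = [0,1]^D`. -/
abbrev Cube (D : ℕ) : Type := Set.Icc (0 : Fin D → ℝ) 1

/-- The spatial centered grid. -/
abbrev XGrid {D : ℕ} (n : Fin (D + 1) → ℕ) : Type := (d : Fin D) → Fin (n d.succ + 1)

/-- The cell `{y ∈ X | |i_d h_d - y_d| ≤ h_d / 2 for d = 1, …, D}` around a spatial grid point. -/
def cell {D : ℕ} (n : Fin (D + 1) → ℕ) (i : XGrid n) : Set (Cube D) :=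
  {y | ∀ d : Fin D, |((i d : ℕ) : ℝ) * (1 / (n d.succ : ℝ)) - y.1 d| ≤ (1 / (n d.succ : ℝ)) / 2}

/-- The discretized density `ρ(X_i) / ∑_j ρ(X_j) h_X` with `h_X = h_1 ⋯ h_D`. -/
noncomputable def discreteDensity {D : ℕ} (n : Fin (D + 1) → ℕ) (ρ : Measure (Cube D))
    (i : XGrid n) : ℝ :=
  ρ.real (cell n i) / ∑ j : XGrid n, ρ.real (cell n j) * ∏ d : Fin D, (1 / (n d.succ : ℝ))

/-- The cost vector `c`: the discretized `ρ₀` at the initial time level, minus the discretized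
`ρ₁` at the final time level, zero in between. -/
noncomputable def costVec {D : ℕ} (n : Fin (D + 1) → ℕ) (ρ₀ ρ₁ : Measure (Cube D)) : CSpace n :=
  WithLp.toLp 2 fun i =>
    if (i 0 : ℕ) = 0 then discreteDensity n ρ₀ (fun d => i d.succ)
    else if (i 0 : ℕ) = n 0 then -discreteDensity n ρ₁ (fun d => i d.succ)
    else 0

/-! ### Range space, KKT systems, augmented Lagrangian, algorithm -/

/-- The range of the adjoint `A*` of the discrete gradient. -/
noncomputable def rgeAdj {D : ℕ} (n : Fin (D + 1) → ℕ) : Submodule ℝ (CSpace n) :=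
  LinearMap.range (LinearMap.adjoint (gradOp n))

/-- The KKT system of
`min ⟨c, φ⟩ + δ_Q(z)` subject to `A φ - q = 0` and `z - B F q = d`. -/
structure IsKKT {D : ℕ} (n : Fin (D + 1) → ℕ) (c : CSpace n)
    (φ : CSpace n) (z : KSpace n) (q α : SSpace n) (β : KSpace n) : Prop where
  primal_q : gradOp n φ - q = 0
  primal_z : z - BF n q - shiftVec n = 0
  dual_φ : LinearMap.adjoint (gradOp n) α + c = 0
  dual_q : α + LinearMap.adjoint (BF n) β = 0
  z_mem : z ∈ coneQ n
  β_mem : β ∈ coneQ n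
  compl : inner ℝ z β = 0

/-- The KKT system of the same problem with the additional restriction `φ ∈ rge(A*)`. -/
structure IsRestrictedKKT {D : ℕ} (n : Fin (D + 1) → ℕ) (c : CSpace n)
    (φ : CSpace n) (z : KSpace n) (q α : SSpace n) (β : KSpace n) : Prop
    extends IsKKT n c φ z q α β where
  φ_mem : φ ∈ rgeAdj n

/-- The augmented Lagrangian function `L_σ(φ, z, q; α, β)`. -/
noncomputable def augLagrangian {D : ℕ} (n : Fin (D + 1) → ℕ) (c : CSpace n) (σ : ℝ)
    (φ : CSpace n) (z : KSpace n) (q α : SSpace n) (β : KSpace n) : EReal :=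
  ((inner ℝ c φ + inner ℝ (gradOp n φ - q) α + inner ℝ (z - BF n q - shiftVec n) β
      + σ / 2 * ‖gradOp n φ - q‖ ^ 2 + σ / 2 * ‖z - BF n q - shiftVec n‖ ^ 2 : ℝ) : EReal)
    + indQ n z

/-- The sequence `(φ k, z k, q k, α k, β k)` is generated by the inexact proximal ALM with penalty
parameter `σ` and dual step length `τ` from the initial point `(q₀, α₀, β₀)`. The algorithm has no
initial `φ` and `z`, so `φ 0` and `z 0` are not constrained. -/
structure IsALMSequence {D : ℕ} (n : Fin (D + 1) → ℕ) (c : CSpace n) (σ τ : ℝ)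
    (q₀ α₀ : SSpace n) (β₀ : KSpace n)
    (φ : ℕ → CSpace n) (z : ℕ → KSpace n) (q α : ℕ → SSpace n) (β : ℕ → KSpace n) : Prop where
  init_q : q 0 = q₀
  init_α : α 0 = α₀
  init_β : β 0 = β₀
  /-- `(φ^{k+1}, z^{k+1})` minimizes `L_σ(·, ·, q^k; α^k, β^k)` over `φ ∈ rge(A*)`. -/
  step_φz_mem : ∀ k, φ (k + 1) ∈ rgeAdj n
  step_φz_min : ∀ k, ∀ φ' ∈ rgeAdj n, ∀ z' : KSpace n,
    augLagrangian n c σ (φ (k + 1)) (z (k + 1)) (q k) (α k) (β k)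
      ≤ augLagrangian n c σ φ' z' (q k) (α k) (β k)
  /-- `q^{k+1}` minimizes `L_σ(φ^{k+1}, z^{k+1}, ·; α^k, β^k)`. -/
  step_q_min : ∀ k, ∀ q' : SSpace n,
    augLagrangian n c σ (φ (k + 1)) (z (k + 1)) (q (k + 1)) (α k) (β k)
      ≤ augLagrangian n c σ (φ (k + 1)) (z (k + 1)) q' (α k) (β k)
  step_α : ∀ k, α (k + 1) = α k + (τ * σ) • (gradOp n (φ (k + 1)) - q (k + 1))
  step_β : ∀ k, β (k + 1) =
    β k + (τ * σ) • (z (k + 1) - BF n (q (k + 1)) - shiftVec n)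

end DiscreteDOT

namespace DiscreteDOT

/-! Grouping `(φ, z)` into one block `u` and `(α, β)` into one multiplier `l`, the algorithm is a
two-block alternating direction method for minimizing a linear `f u` over a closed convex set `C`
under `M u - N q = b`. The objective does not involve `q`, which is what admits every step length in
`(0, 2)`. Indeed, optimality in `q` makes `l k + σ • r` orthogonal to the range of `N`, where `r` is
the new residual, so the component of `l k` along that range is multiplied by `1 - τ` at each step.
The only unsigned term in the usual energy estimate is therefore geometrically small
(`IsADMM.lyapunov_succ_le`).

Consequently the energy is monotone up to a summable error, the residuals vanish, and the iterates
stay bounded because `M` is bounded below on differences of points of `C` and `N` on its whole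
domain. A cluster point is a saddle point; the energy relative to it converges, and tends to `0`
along a subsequence, hence entirely (`IsADMM.tendsto`).

The argument needs one saddle point, which conic duality supplies (`exists_isRestrictedKKT`). The
primal program satisfies Slater's condition. On the dual side, the two normalized densities have
equal mass, so the discrete continuity equation has a solution with constant positive density, and
this lifts to an interior dual point. The interior dual point makes the primal program attain its
minimum; Slater's condition provides the multiplier. -/

theorem nonneg_of_forall_mul_add_sq_mul {a r : ℝ}
    (h : ∀ t : ℝ, 0 < t → t ≤ 1 → 0 ≤ t * a + t ^ 2 * r) : 0 ≤ a := by
  by_contra! ha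
  -- For this `t` one has `t * |r| < -a / 2`, so `a + t * r` is still negative.
  set t := min 1 (-a / (2 * (|r| + 1))) with ht
  have hr : 0 < 2 * (|r| + 1) := by positivity
  have ht0 : 0 < t := lt_min one_pos (div_pos (neg_pos.2 ha) hr)
  have h1 := h t ht0 (min_le_left _ _)
  have h2 : t * (2 * (|r| + 1)) ≤ -a := (le_div_iff₀ hr).1 (min_le_right _ _)
  have h3 : 0 ≤ a + t * r := by
    have : 0 ≤ t * (a + t * r) := by nlinarith
    exact nonneg_of_mul_nonneg_right this ht0
  nlinarith [le_abs_self r, abs_nonneg r]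

/-! ### Alternating direction method with an objective-free second block -/

section ADMM

variable {E V W : Type*} [NormedAddCommGroup E] [NormedSpace ℝ E]
  [NormedAddCommGroup V] [NormedSpace ℝ V] [NormedAddCommGroup W] [InnerProductSpace ℝ W]

/-- A linear function plus a quadratic that is coercive on a closed set attains its minimum
there. -/
theorem exists_min_linear_add_sq [FiniteDimensional ℝ E] {C : Set E} (hC : IsClosed C)
    (hne : C.Nonempty) (M : E →ₗ[ℝ] W)
    {m : ℝ} (hM : ∀ u ∈ C, ∀ u' ∈ C, ‖u - u'‖ ≤ m * ‖M (u - u')‖) (f : E →ₗ[ℝ] ℝ) (w : W)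
    {σ : ℝ} (hσ : 0 < σ) :
    ∃ u ∈ C, ∀ u' ∈ C, f u + σ / 2 * ‖M u - w‖ ^ 2 ≤ f u' + σ / 2 * ‖M u' - w‖ ^ 2 := by
  obtain ⟨u₀, hu₀⟩ := hne
  have hfc : Continuous f := f.continuous_of_finiteDimensional
  have hMc : Continuous M := M.continuous_of_finiteDimensional
  have hcont : Continuous fun u => f u + σ / 2 * ‖M u - w‖ ^ 2 := by fun_prop
  obtain ⟨K, hK0, hK⟩ : ∃ K : ℝ, 0 ≤ K ∧ ∀ u, |f u| ≤ K * ‖u‖ :=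
    ⟨‖LinearMap.toContinuousLinearMap f‖, norm_nonneg _,
      fun u => (LinearMap.toContinuousLinearMap f).le_opNorm u⟩
  set m' := max m 1 with hm'
  have hm'0 : 0 < m' := lt_of_lt_of_le one_pos (le_max_right _ _)
  set y₀ := ‖M u₀ - w‖ with hy₀
  have hy₀0 : 0 ≤ y₀ := norm_nonneg _
  -- With `y = ‖M u - w‖`, coercivity bounds the loss in `f` by `K * m' * (y + y₀)`. Once `y ≥ p₀ ≥
  -- 1`, the quadratic `σ / 2 * y ^ 2` exceeds this loss plus `σ / 2 * y₀ ^ 2`.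
  set p₀ := 1 + 2 / σ * (K * m' + K * m' * y₀ + σ / 2 * y₀ ^ 2) with hp₀
  have hev : ∀ᶠ u in cocompact E ⊓ 𝓟 C,
      f u₀ + σ / 2 * ‖M u₀ - w‖ ^ 2 ≤ f u + σ / 2 * ‖M u - w‖ ^ 2 := by
    have h1 : ∀ᶠ u in cocompact E, m' * (p₀ + y₀) ≤ ‖u - u₀‖ := by
      have h := tendsto_norm_cocompact_atTop (E := E)
      filter_upwards [h.eventually_ge_atTop (m' * (p₀ + y₀) + ‖u₀‖)] with u hu
      have := norm_sub_norm_le u u₀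
      linarith
    rw [eventually_inf_principal]
    filter_upwards [h1] with u hu huC
    have hx : ‖u - u₀‖ ≤ m' * (‖M u - w‖ + y₀) := by
      calc ‖u - u₀‖ ≤ m * ‖M (u - u₀)‖ := hM u huC u₀ hu₀
        _ ≤ m' * ‖M (u - u₀)‖ := by gcongr; exact le_max_left _ _
        _ ≤ m' * (‖M u - w‖ + y₀) := by
          gcongr
          have : M (u - u₀) = (M u - w) - (M u₀ - w) := by rw [map_sub]; abel
          rw [this]; exact norm_sub_le _ _
    set y := ‖M u - w‖ with hy
    have hyp : p₀ ≤ y := by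
      have := le_of_mul_le_mul_left (hu.trans hx) hm'0
      linarith
    have hf := hK (u - u₀)
    rw [map_sub] at hf
    have hf' := (abs_le.1 hf).1
    have hKx : K * ‖u - u₀‖ ≤ K * m' * y + K * m' * y₀ := by
      have := mul_le_mul_of_nonneg_left hx hK0
      linarith
    have hB : 0 ≤ K * m' + K * m' * y₀ + σ / 2 * y₀ ^ 2 := by positivity
    have hp1 : 1 ≤ p₀ := le_add_of_nonneg_right (mul_nonneg (by positivity) hB)
    have hy1 : 1 ≤ y := hp1.trans hyp
    have hsy : K * m' + K * m' * y₀ + σ / 2 * y₀ ^ 2 ≤ σ / 2 * y := by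
      have h2 : σ / 2 * p₀ = σ / 2 + (K * m' + K * m' * y₀ + σ / 2 * y₀ ^ 2) := by
        rw [hp₀]; field_simp
      have h3 : σ / 2 * p₀ ≤ σ / 2 * y := by gcongr
      linarith
    have h4 : (K * m' + K * m' * y₀ + σ / 2 * y₀ ^ 2) * y ≤ σ / 2 * y * y := by gcongr
    have h5 : K * m' * y₀ + σ / 2 * y₀ ^ 2 ≤ (K * m' * y₀ + σ / 2 * y₀ ^ 2) * y :=
      le_mul_of_one_le_right (by positivity) hy1
    nlinarith
  obtain ⟨u, hu, hmin⟩ := hcont.continuousOn.exists_isMinOn' hC hu₀ hev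
  exact ⟨u, hu, fun u' hu' => hmin hu'⟩

/-- First-order optimality condition for the augmented Lagrangian on a convex set. -/
theorem variational_of_min {C : Set E} (hC : Convex ℝ C) (M : E →ₗ[ℝ] W) (f : E →ₗ[ℝ] ℝ)
    (l w : W) {σ : ℝ} {u : E} (hu : u ∈ C)
    (hmin : ∀ u' ∈ C, f u + inner ℝ (M u - w) l + σ / 2 * ‖M u - w‖ ^ 2
      ≤ f u' + inner ℝ (M u' - w) l + σ / 2 * ‖M u' - w‖ ^ 2) :
    ∀ u' ∈ C, 0 ≤ f (u' - u) + inner ℝ (l + σ • (M u - w)) (M (u' - u)) := by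
  intro u' hu'
  -- Along the segment from `u` to `u'` the objective increases by exactly `t * a + t ^ 2 * r`, with
  -- `a` the directional derivative.
  refine nonneg_of_forall_mul_add_sq_mul (r := σ / 2 * ‖M (u' - u)‖ ^ 2) fun t ht0 ht1 => ?_
  have h := hmin _ (hC.add_smul_sub_mem hu hu' ⟨ht0.le, ht1⟩)
  have e : M (u + t • (u' - u)) - w = (M u - w) + t • M (u' - u) := by
    rw [map_add, map_smul]; abel
  rw [e, map_add, map_smul, norm_add_sq_real, inner_add_left, norm_smul, real_inner_smul_left,
    real_inner_smul_right, mul_pow, Real.norm_eq_abs, sq_abs, smul_eq_mul,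
    real_inner_comm l (M (u' - u))] at h
  rw [inner_add_left, real_inner_smul_left]
  rw [real_inner_comm] at h
  nlinarith [h, real_inner_comm l (M (u' - u))]

/-- The saddle points of `min f u` subject to `M u - N q = b`, `u ∈ C`, in variational form. -/
structure IsSaddle (C : Set E) (f : E →ₗ[ℝ] ℝ) (M : E →ₗ[ℝ] W) (N : V →ₗ[ℝ] W) (b : W)
    (u : E) (q : V) (l : W) : Prop where
  mem : u ∈ C
  feasible : M u - N q - b = 0
  normal : ∀ v, inner ℝ l (N v) = 0
  variational : ∀ u' ∈ C, 0 ≤ f (u' - u) + inner ℝ l (M (u' - u))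

/-- The iterates of the alternating direction method, with its two minimization steps expressed by
their optimality conditions. -/
structure IsADMM (C : Set E) (f : E →ₗ[ℝ] ℝ) (M : E →ₗ[ℝ] W) (N : V →ₗ[ℝ] W) (b : W) (σ τ : ℝ)
    (u : ℕ → E) (q : ℕ → V) (l : ℕ → W) : Prop where
  mem : ∀ k, u (k + 1) ∈ C
  variational : ∀ k, ∀ u' ∈ C, 0 ≤ f (u' - u (k + 1)) +
    inner ℝ (l k + σ • (M (u (k + 1)) - N (q k) - b)) (M (u' - u (k + 1)))
  normal : ∀ k v, inner ℝ (l k + σ • (M (u (k + 1)) - N (q (k + 1)) - b)) (N v) = 0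
  step : ∀ k, l (k + 1) = l k + (τ * σ) • (M (u (k + 1)) - N (q (k + 1)) - b)

variable {C : Set E} {f : E →ₗ[ℝ] ℝ} {M : E →ₗ[ℝ] W} {N : V →ₗ[ℝ] W} {b : W} {σ τ : ℝ}
  {u : ℕ → E} {q : ℕ → V} {l : ℕ → W} {us : E} {qs : V} {ls : W}

/-- By `normal`, the residual paired with `N v` equals `-1 / σ` times `l k` paired with `N v`; the
dual step of length `τ * σ` thus scales this pairing by `1 - τ`. The initial multiplier need not be
orthogonal to the range of `N`. -/
theorem IsADMM.inner_multiplier (h : IsADMM C f M N b σ τ u q l) (k : ℕ) (v : V) :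
    inner ℝ (l k) (N v) = (1 - τ) ^ k * inner ℝ (l 0) (N v) := by
  induction k with
  | zero => simp
  | succ k ih =>
    have h1 := h.normal k v
    rw [inner_add_left, real_inner_smul_left] at h1
    rw [h.step k, inner_add_left, real_inner_smul_left, pow_succ]
    linear_combination τ * h1 + (1 - τ) * ih

/-- The Lyapunov function of the method. -/
noncomputable def lyapunov (N : V →ₗ[ℝ] W) (σ τ : ℝ) (qs : V) (ls : W) (q : V) (l : W) : ℝ :=
  ‖l - ls‖ ^ 2 / (τ * σ) + σ * ‖N (q - qs)‖ ^ 2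

/-- The optimality condition of the iterate is tested at the saddle point and conversely; in the sum
the values of `f` cancel. Orthogonality to the range of `N` removes all cross terms except `inner ℝ
(l k) p`, which `IsADMM.inner_multiplier` shows to be geometrically small. -/
theorem IsADMM.lyapunov_succ_le (h : IsADMM C f M N b σ τ u q l) (hσ : 0 < σ) (hτ : 0 < τ)
    (hs : IsSaddle C f M N b us qs ls) (k : ℕ) :
    lyapunov N σ τ qs ls (q (k + 1)) (l (k + 1))
      + (2 - τ) * σ * ‖M (u (k + 1)) - N (q (k + 1)) - b‖ ^ 2
      + σ / 2 * ‖N (q (k + 1) - q k)‖ ^ 2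
      ≤ lyapunov N σ τ qs ls (q k) (l k) + 2 / σ * ‖l 0‖ ^ 2 * ((1 - τ) ^ 2) ^ k := by
  set r := M (u (k + 1)) - N (q (k + 1)) - b with hr
  set p := N (q (k + 1) - q k) with hp
  set s := N (q (k + 1) - qs) with hs'
  have h1 := h.variational k us hs.mem
  have h2 := hs.variational _ (h.mem k)
  have e1 : M (u (k + 1)) - N (q k) - b = r + p := by
    rw [hr, hp, map_sub]; abel
  have e2 : M (us - u (k + 1)) = -(r + s) := by
    have := hs.feasible
    rw [hr, hs', map_sub, map_sub]
    have : M us = N qs + b := by rw [← sub_eq_zero, ← this]; abel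
    rw [this]; abel
  have e3 : M (u (k + 1) - us) = r + s := by
    rw [← neg_sub, map_neg, e2, neg_neg]
  have e4 : f (us - u (k + 1)) = -f (u (k + 1) - us) := by rw [← map_neg, neg_sub]
  have n1 : inner ℝ (l k) s + σ * inner ℝ r s = 0 := by
    have := h.normal k (q (k + 1) - qs)
    rwa [inner_add_left, real_inner_smul_left] at this
  have n2 : inner ℝ (l k) p + σ * inner ℝ r p = 0 := by
    have := h.normal k (q (k + 1) - q k)
    rwa [inner_add_left, real_inner_smul_left] at this
  have n3 : inner ℝ ls s = 0 := hs.normal _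
  have n4 : inner ℝ (l k) p = (1 - τ) ^ k * inner ℝ (l 0) p := h.inner_multiplier k _
  rw [e1, e2, e4, inner_neg_right, smul_add, inner_add_left, inner_add_left,
    real_inner_smul_left, real_inner_smul_left, inner_add_right, inner_add_right,
    inner_add_right, real_inner_self_eq_norm_sq] at h1
  rw [e3, inner_add_right] at h2
  have e5 : N (q k - qs) = s - p := by rw [hs', hp, ← map_sub]; congr 1; abel
  have e6 : l (k + 1) - ls = (l k - ls) + (τ * σ) • r := by rw [h.step k]; abel
  -- Young's inequality. The term enters twice, so half of the available `σ * ‖p‖ ^ 2` is spent on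
  -- it.
  have hb : (1 - τ) ^ k * inner ℝ (l 0) p ≤ σ / 4 * ‖p‖ ^ 2
      + 1 / σ * ‖l 0‖ ^ 2 * ((1 - τ) ^ 2) ^ k := by
    have hcs : |inner ℝ (l 0) p| ≤ ‖l 0‖ * ‖p‖ := abs_real_inner_le_norm _ _
    have h3 : (1 - τ) ^ k * inner ℝ (l 0) p ≤ |(1 - τ) ^ k| * (‖l 0‖ * ‖p‖) := by
      refine (le_abs_self _).trans ?_
      rw [abs_mul]; gcongr
    refine h3.trans ?_
    have h4 : ((1 - τ) ^ 2) ^ k = |(1 - τ) ^ k| ^ 2 := by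
      rw [sq_abs, ← pow_mul, ← pow_mul, mul_comm]
    rw [h4]
    have h5 : 0 ≤ (σ / 2 * ‖p‖ - |(1 - τ) ^ k| * ‖l 0‖) ^ 2 / σ := by positivity
    have h6 : (σ / 2 * ‖p‖ - |(1 - τ) ^ k| * ‖l 0‖) ^ 2 / σ = σ / 4 * ‖p‖ ^ 2
      - |(1 - τ) ^ k| * (‖l 0‖ * ‖p‖) + 1 / σ * ‖l 0‖ ^ 2 * |(1 - τ) ^ k| ^ 2 := by
      field_simp; ring
    linarith
  unfold lyapunov
  rw [e5, e6, ← hs', norm_sub_sq_real s p, norm_add_sq_real (l k - ls), norm_smul,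
    real_inner_smul_right, inner_sub_left, mul_pow, Real.norm_eq_abs, sq_abs]
  have e7 : (‖l k - ls‖ ^ 2 + 2 * (τ * σ * (inner ℝ (l k) r - inner ℝ ls r))
      + (τ * σ) ^ 2 * ‖r‖ ^ 2) / (τ * σ) = ‖l k - ls‖ ^ 2 / (τ * σ)
      + 2 * (inner ℝ (l k) r - inner ℝ ls r) + τ * σ * ‖r‖ ^ 2 := by
    field_simp
  rw [e7]
  have c1 : inner ℝ p r = inner ℝ r p := real_inner_comm _ _
  have c2 : inner ℝ p s = inner ℝ s p := real_inner_comm _ _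
  have e8 : 2 / σ * ‖l 0‖ ^ 2 * ((1 - τ) ^ 2) ^ k
    = 2 * (1 / σ * ‖l 0‖ ^ 2 * ((1 - τ) ^ 2) ^ k) := by ring
  rw [e8]
  rw [c1, c2] at h1
  linarith

/-- Adding the remaining tail of the geometric error series to the energy turns almost-monotonicity
into monotonicity. -/
theorem IsADMM.exists_antitone (h : IsADMM C f M N b σ τ u q l) (hσ : 0 < σ)
    (hτ : τ ∈ Set.Ioo (0 : ℝ) 2) (hs : IsSaddle C f M N b us qs ls) :
    ∃ e : ℕ → ℝ, Tendsto e atTop (𝓝 0) ∧ (∀ k, 0 ≤ e k) ∧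
      ∀ k, (lyapunov N σ τ qs ls (q (k + 1)) (l (k + 1)) + e (k + 1))
        + (2 - τ) * σ * ‖M (u (k + 1)) - N (q (k + 1)) - b‖ ^ 2
        + σ / 2 * ‖N (q (k + 1) - q k)‖ ^ 2 ≤ lyapunov N σ τ qs ls (q k) (l k) + e k := by
  obtain ⟨hτ0, hτ2⟩ := hτ
  have hρ : (1 - τ) ^ 2 < 1 := by nlinarith
  have hρ1 : 0 < 1 - (1 - τ) ^ 2 := by linarith
  refine ⟨fun k => 2 / σ * ‖l 0‖ ^ 2 / (1 - (1 - τ) ^ 2) * ((1 - τ) ^ 2) ^ k, ?_, ?_, ?_⟩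
  · simpa using (tendsto_pow_atTop_nhds_zero_of_lt_one (sq_nonneg (1 - τ)) hρ).const_mul
      (2 / σ * ‖l 0‖ ^ 2 / (1 - (1 - τ) ^ 2))
  · intro k; positivity
  · intro k
    have h1 := h.lyapunov_succ_le hσ hτ0 hs k
    have h2 : 2 / σ * ‖l 0‖ ^ 2 / (1 - (1 - τ) ^ 2) * ((1 - τ) ^ 2) ^ k
        - 2 / σ * ‖l 0‖ ^ 2 / (1 - (1 - τ) ^ 2) * ((1 - τ) ^ 2) ^ (k + 1)
        = 2 / σ * ‖l 0‖ ^ 2 * ((1 - τ) ^ 2) ^ k := by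
      field_simp
      ring
    linarith

theorem lyapunov_nonneg (hσ : 0 < σ) (hτ : 0 < τ) (q : V) (l : W) :
    0 ≤ lyapunov N σ τ qs ls q l := by
  unfold lyapunov; positivity

theorem norm_sub_le_of_lyapunov_le (hσ : 0 < σ) (hτ : 0 < τ) {q : V} {l : W} {B : ℝ}
    (hB : lyapunov N σ τ qs ls q l ≤ B) :
    ‖l - ls‖ ^ 2 ≤ τ * σ * B ∧ ‖N (q - qs)‖ ^ 2 ≤ B / σ := by
  unfold lyapunov at hB
  have h1 : 0 ≤ ‖l - ls‖ ^ 2 / (τ * σ) := by positivity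
  have h2 : 0 ≤ σ * ‖N (q - qs)‖ ^ 2 := by positivity
  have hτσ : 0 < τ * σ := by positivity
  constructor
  · rw [mul_comm, ← div_le_iff₀ hτσ]; linarith
  · rw [le_div_iff₀ hσ]; linarith

theorem tendsto_of_lyapunov {q : ℕ → V} {l : ℕ → W} (hσ : 0 < σ) (hτ : 0 < τ)
    (h : Tendsto (fun k => lyapunov N σ τ qs ls (q k) (l k)) atTop (𝓝 0)) :
    Tendsto l atTop (𝓝 ls) ∧ Tendsto (fun k => N (q k - qs)) atTop (𝓝 0) := by
  have key : ∀ {x : ℕ → W} {K : ℝ}, (∀ k, ‖x k‖ ^ 2 ≤ K * lyapunov N σ τ qs ls (q k) (l k)) →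
      Tendsto x atTop (𝓝 0) := by
    intro x K hx
    rw [tendsto_zero_iff_norm_tendsto_zero]
    have h2 : Tendsto (fun k => ‖x k‖ ^ 2) atTop (𝓝 0) :=
      squeeze_zero (fun k => sq_nonneg _) hx (by simpa using h.const_mul K)
    have h3 := h2.sqrt
    simpa [Real.sqrt_sq (norm_nonneg _)] using h3
  constructor
  · rw [tendsto_iff_norm_sub_tendsto_zero, ← tendsto_zero_iff_norm_tendsto_zero]
    exact key fun k => (norm_sub_le_of_lyapunov_le hσ hτ le_rfl).1
  · refine key (K := 1 / σ) fun k => ?_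
    have := (norm_sub_le_of_lyapunov_le (N := N) (qs := qs) (ls := ls) hσ hτ
      (le_refl (lyapunov N σ τ qs ls (q k) (l k)))).2
    rwa [one_div, inv_mul_eq_div]

/-- Convergence of the alternating direction method with step length in `(0, 2)` when the second
block of the objective vanishes. -/
theorem IsADMM.tendsto [FiniteDimensional ℝ E] [FiniteDimensional ℝ V] [FiniteDimensional ℝ W]
    (h : IsADMM C f M N b σ τ u q l) (hσ : 0 < σ)
    (hτ : τ ∈ Set.Ioo (0 : ℝ) 2) (hC : IsClosed C) {m m' : ℝ}
    (hM : ∀ u ∈ C, ∀ u' ∈ C, ‖u - u'‖ ≤ m * ‖M (u - u')‖) (hN : ∀ v, ‖v‖ ≤ m' * ‖N v‖)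
    (hs : IsSaddle C f M N b us qs ls) :
    ∃ us qs ls, IsSaddle C f M N b us qs ls ∧ Tendsto u atTop (𝓝 us) ∧ Tendsto q atTop (𝓝 qs) ∧
      Tendsto l atTop (𝓝 ls) := by
  have hτ0 := hτ.1
  have hτ2 : 0 < (2 - τ) * σ := mul_pos (by linarith [hτ.2]) hσ
  have hMc : Continuous M := M.continuous_of_finiteDimensional
  have hNc : Continuous N := N.continuous_of_finiteDimensional
  have hfc : Continuous f := f.continuous_of_finiteDimensional
  set r : ℕ → W := fun k => M (u (k + 1)) - N (q (k + 1)) - b with hr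
  have sq_tendsto : ∀ {x : ℕ → W} {K : ℝ} {y : ℕ → ℝ}, 0 < K → Tendsto y atTop (𝓝 0) →
      (∀ k, K * ‖x k‖ ^ 2 ≤ y k) → Tendsto x atTop (𝓝 0) := by
    intro x K y hK hy hx
    rw [tendsto_zero_iff_norm_tendsto_zero]
    have hx' : ∀ k, ‖x k‖ ^ 2 ≤ y k / K := fun k => by
      rw [le_div_iff₀ hK, mul_comm]; exact hx k
    have h2 : Tendsto (fun k => ‖x k‖ ^ 2) atTop (𝓝 0) :=
      squeeze_zero (fun k => sq_nonneg _) hx' (by simpa using hy.div_const K)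
    simpa [Real.sqrt_sq (norm_nonneg _)] using h2.sqrt
  -- consequences of the descent inequality for an arbitrary saddle point
  have main : ∀ {us qs ls}, IsSaddle C f M N b us qs ls →
      (∃ L, Tendsto (fun k => lyapunov N σ τ qs ls (q k) (l k)) atTop (𝓝 L)) ∧
      (∃ B, ∀ k, lyapunov N σ τ qs ls (q k) (l k) ≤ B) ∧
      Tendsto r atTop (𝓝 0) ∧ Tendsto (fun k => N (q (k + 1) - q k)) atTop (𝓝 0) := by
    intro us qs ls hs
    obtain ⟨e, he, he0, hle⟩ := h.exists_antitone hσ hτ hs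
    set Ψ : ℕ → ℝ := fun k => lyapunov N σ τ qs ls (q k) (l k) + e k with hΨ
    have hnn : ∀ k, 0 ≤ lyapunov N σ τ qs ls (q k) (l k) := fun k => lyapunov_nonneg hσ hτ0 _ _
    have hr0 : ∀ k, 0 ≤ (2 - τ) * σ * ‖r k‖ ^ 2 := fun k => by positivity
    have hp0 : ∀ k, 0 ≤ σ / 2 * ‖N (q (k + 1) - q k)‖ ^ 2 := fun k => by positivity
    have hle' : ∀ k, Ψ (k + 1) + (2 - τ) * σ * ‖r k‖ ^ 2
      + σ / 2 * ‖N (q (k + 1) - q k)‖ ^ 2 ≤ Ψ k := hle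
    have hanti : Antitone Ψ := antitone_nat_of_succ_le fun k => by
      linarith [hle' k, hr0 k, hp0 k]
    have hbdd : BddBelow (Set.range Ψ) := ⟨0, by
      rintro _ ⟨k, rfl⟩; exact add_nonneg (hnn k) (he0 k)⟩
    have hlim := tendsto_atTop_ciInf hanti hbdd
    have hdiff : Tendsto (fun k => Ψ k - Ψ (k + 1)) atTop (𝓝 0) := by
      simpa using hlim.sub (hlim.comp (tendsto_add_atTop_nat 1))
    refine ⟨⟨_, by simpa [hΨ] using hlim.sub he⟩, ⟨Ψ 0, fun k => ?_⟩, ?_, ?_⟩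
    · have := hanti (Nat.zero_le k)
      have h3 := he0 k
      simp only [hΨ] at this ⊢
      linarith
    · exact sq_tendsto hτ2 hdiff fun k => by linarith [hle' k, hp0 k]
    · exact sq_tendsto (half_pos hσ) hdiff fun k => by linarith [hle' k, hr0 k]
  obtain ⟨-, ⟨B, hB⟩, hr0, hp0⟩ := main hs
  have hNtend : ∀ {x : ℕ → V}, Tendsto (fun k => N (x k)) atTop (𝓝 0) → Tendsto x atTop (𝓝 0) := by
    intro x hx
    rw [tendsto_zero_iff_norm_tendsto_zero]
    exact squeeze_zero (fun k => norm_nonneg _) (fun k => hN _) (by simpa using hx.norm.const_mul m')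
  -- boundedness
  have hlb : ∀ k, ‖l k‖ ≤ ‖ls‖ + √(τ * σ * B) := fun k => by
    have h1 := Real.le_sqrt_of_sq_le (norm_sub_le_of_lyapunov_le hσ hτ0 (hB k)).1
    have h2 := norm_le_norm_add_norm_sub' (l k) ls
    linarith
  have hqN : ∀ k, ‖N (q k - qs)‖ ≤ √(B / σ) := fun k =>
    Real.le_sqrt_of_sq_le (norm_sub_le_of_lyapunov_le hσ hτ0 (hB k)).2
  have hqb : ∀ k, ‖q k‖ ≤ ‖qs‖ + |m'| * √(B / σ) := fun k => by
    have h1 : ‖q k - qs‖ ≤ |m'| * √(B / σ) := (hN _).trans <| by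
      gcongr
      · exact le_abs_self _
      · exact hqN k
    have h2 := norm_le_norm_add_norm_sub' (q k) qs
    linarith
  obtain ⟨R, hR⟩ : ∃ R, ∀ k, ‖r k‖ ≤ R := by
    obtain ⟨R, hR⟩ := hr0.norm.bddAbove_range
    exact ⟨R, fun k => hR ⟨k, rfl⟩⟩
  -- The residual identity expresses `M (u (k + 1) - us)` through quantities already bounded.
  have hub : ∀ k, ‖u (k + 1)‖ ≤ ‖us‖ + |m| * (R + √(B / σ)) := fun k => by
    have e : M (u (k + 1) - us) = r k + N (q (k + 1) - qs) := by
      have := hs.feasible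
      have : M us = N qs + b := by rw [← sub_eq_zero, ← this]; abel
      simp only [hr, map_sub, this]
      abel
    have h1 : ‖u (k + 1) - us‖ ≤ |m| * (R + √(B / σ)) := (hM _ (h.mem k) _ hs.mem).trans <| by
      gcongr
      · exact le_abs_self _
      · rw [e]; exact (norm_add_le _ _).trans (add_le_add (hR k) (hqN _))
    have h2 := norm_le_norm_add_norm_sub' (u (k + 1)) us
    linarith
  obtain ⟨⟨u', q', l'⟩, -, θ, hθ, hlim⟩ := tendsto_subseq_of_bounded
    (s := Metric.closedBall (0 : E) (‖us‖ + |m| * (R + √(B / σ))) ×ˢ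
      (Metric.closedBall (0 : V) (‖qs‖ + |m'| * √(B / σ)) ×ˢ
        Metric.closedBall (0 : W) (‖ls‖ + √(τ * σ * B))))
    (Metric.isBounded_closedBall.prod (Metric.isBounded_closedBall.prod
      Metric.isBounded_closedBall))
    (x := fun k => (u (k + 1), q (k + 1), l (k + 1)))
    (fun k => ⟨by simpa using hub k, by simpa using hqb _, by simpa using hlb _⟩)
  have hu' : Tendsto (fun k => u (θ k + 1)) atTop (𝓝 u') := hlim.fst_nhds
  have hq' : Tendsto (fun k => q (θ k + 1)) atTop (𝓝 q') := hlim.snd_nhds.fst_nhds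
  have hl' : Tendsto (fun k => l (θ k + 1)) atTop (𝓝 l') := hlim.snd_nhds.snd_nhds
  have hθ' := hθ.tendsto_atTop
  have hrθ : Tendsto (fun k => r (θ k)) atTop (𝓝 0) := hr0.comp hθ'
  have hpθ : Tendsto (fun k => N (q (θ k + 1) - q (θ k))) atTop (𝓝 0) := hp0.comp hθ'
  -- The optimality conditions at step `θ k` contain the old multiplier; it has the same limit as
  -- the new one because they differ by a multiple of the residual.
  have hlθ : Tendsto (fun k => l (θ k)) atTop (𝓝 l') := by
    have h1 := hl'.sub (hrθ.const_smul (τ * σ))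
    rw [smul_zero, sub_zero] at h1
    refine h1.congr fun k => ?_
    rw [h.step]; simp [hr]
  have hsad : IsSaddle C f M N b u' q' l' := by
    refine ⟨hC.mem_of_tendsto hu' (Eventually.of_forall fun k => h.mem _), ?_, fun v => ?_,
      fun w hw => ?_⟩
    · refine tendsto_nhds_unique ?_ hrθ
      exact ((hMc.tendsto _).comp hu').sub ((hNc.tendsto _).comp hq') |>.sub_const b
    · refine tendsto_nhds_unique (hlθ.inner tendsto_const_nhds) ?_
      -- Orthogonality of the limit multiplier comes from the geometric decay, as `|1 - τ| < 1`.
      have h1 : Tendsto (fun k => (1 - τ) ^ θ k * inner ℝ (l 0) (N v)) atTop (𝓝 0) := by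
        have h2 : |1 - τ| < 1 := abs_lt.2 ⟨by linarith [hτ.2], by linarith⟩
        simpa using ((tendsto_pow_atTop_nhds_zero_of_abs_lt_one h2).comp hθ').mul_const _
      exact h1.congr fun k => (h.inner_multiplier _ _).symm
    · have h1 : Tendsto (fun k => f (w - u (θ k + 1)) + inner ℝ (l (θ k) + σ • (r (θ k)
          + N (q (θ k + 1) - q (θ k)))) (M (w - u (θ k + 1)))) atTop
          (𝓝 (f (w - u') + inner ℝ (l' + σ • ((0 : W) + 0)) (M (w - u')))) :=
        ((hfc.tendsto _).comp (hu'.const_sub w)).add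
          ((hlθ.add ((hrθ.add hpθ).const_smul σ)).inner
            ((hMc.tendsto _).comp (hu'.const_sub w)))
      rw [add_zero, smul_zero, add_zero] at h1
      refine ge_of_tendsto' h1 fun k => ?_
      have h2 := h.variational (θ k) w hw
      have e : M (u (θ k + 1)) - N (q (θ k)) - b = r (θ k) + N (q (θ k + 1) - q (θ k)) := by
        simp only [hr, map_sub]; abel
      rwa [e] at h2
  -- The energy is now measured from the cluster point itself: its limit exists and can be computed
  -- along the subsequence.
  obtain ⟨⟨L, hL⟩, -⟩ := main hsad
  have hL0 : L = 0 := by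
    have h1 : Tendsto (fun k => lyapunov N σ τ q' l' (q (θ k + 1)) (l (θ k + 1))) atTop (𝓝 L) :=
      hL.comp ((tendsto_add_atTop_nat 1).comp hθ')
    refine tendsto_nhds_unique h1 ?_
    have h2 : Tendsto (fun k => ‖l (θ k + 1) - l'‖ ^ 2 / (τ * σ)
        + σ * ‖N (q (θ k + 1) - q')‖ ^ 2) atTop
        (𝓝 (‖l' - l'‖ ^ 2 / (τ * σ) + σ * ‖N (q' - q')‖ ^ 2)) :=
      (((hl'.sub_const l').norm.pow 2).div_const _).add
        ((((hNc.tendsto _).comp (hq'.sub_const q')).norm.pow 2).const_mul _)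
    simpa [lyapunov] using h2
  rw [hL0] at hL
  obtain ⟨hll, hqq⟩ := tendsto_of_lyapunov hσ hτ0 hL
  refine ⟨u', q', l', hsad, ?_, ?_, hll⟩
  -- The index is shifted because `u 0` is unconstrained.
  · rw [← tendsto_add_atTop_iff_nat 1, tendsto_iff_norm_sub_tendsto_zero]
    have h1 : Tendsto (fun k => M (u (k + 1) - u')) atTop (𝓝 0) := by
      have h2 := hr0.add (hqq.comp (tendsto_add_atTop_nat 1))
      rw [add_zero] at h2
      refine h2.congr fun k => ?_
      have := hsad.feasible
      have : M u' = N q' + b := by rw [← sub_eq_zero, ← this]; abel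
      simp only [Function.comp, hr, map_sub, this]
      abel
    exact squeeze_zero (fun k => norm_nonneg _) (fun k => hM _ (h.mem k) _ hsad.mem)
      (by simpa using h1.norm.const_mul m)
  · have := hNtend hqq
    simpa using this.add_const q'

end ADMM

/-! ### Attainment and multipliers in conic programming -/

section Conic

variable {X H : Type*} [NormedAddCommGroup X] [InnerProductSpace ℝ X] [FiniteDimensional ℝ X]
  [NormedAddCommGroup H] [InnerProductSpace ℝ H]

/-- Subtracting from `β` a short vector in the direction of `z` stays in `Q`; pairing the result
with `z` gives the bound. -/
theorem exists_mul_norm_le_inner_of_mem_interior {Q : Set H}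
    (hdual : ∀ z ∈ Q, ∀ w ∈ Q, 0 ≤ inner ℝ z w) {β : H} (hβ : β ∈ interior Q) :
    ∃ ε > 0, ∀ z ∈ Q, ε * ‖z‖ ≤ inner ℝ β z := by
  obtain ⟨ε, hε, hball⟩ := Metric.isOpen_iff.1 isOpen_interior β hβ
  refine ⟨ε / 2, half_pos hε, fun z hz => ?_⟩
  rcases eq_or_ne z 0 with rfl | hz0
  · simp
  have hzn : 0 < ‖z‖ := norm_pos_iff.2 hz0
  have hmem : β - (ε / 2 / ‖z‖) • z ∈ Q := by
    refine interior_subset (hball ?_)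
    rw [Metric.mem_ball, dist_eq_norm, sub_sub_cancel_left, norm_neg, norm_smul, Real.norm_eq_abs,
      abs_of_pos (by positivity), div_mul_cancel₀ _ hzn.ne']
    linarith
  have h := hdual _ hmem z hz
  rw [inner_sub_left, real_inner_smul_left, real_inner_self_eq_norm_sq] at h
  have e : ε / 2 / ‖z‖ * ‖z‖ ^ 2 = ε / 2 * ‖z‖ := by field_simp
  linarith

/-- A strictly feasible dual point makes the conic program attain its minimum. -/
theorem exists_conic_min {L : X →ₗ[ℝ] H} {d : H} {Q : Set H} (hQ : IsClosed Q)
    (hdual : ∀ z ∈ Q, ∀ w ∈ Q, 0 ≤ inner ℝ z w) {c : X} {β₀ : H} (hβ₀ : β₀ ∈ interior Q)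
    (hc : ∀ φ, inner ℝ c φ = inner ℝ β₀ (L φ)) {S : Submodule ℝ X} {m : ℝ}
    (hS : ∀ φ ∈ S, ‖φ‖ ≤ m * ‖L φ‖) (hne : ∃ φ ∈ S, L φ + d ∈ Q) :
    ∃ φ ∈ S, L φ + d ∈ Q ∧ ∀ ψ ∈ S, L ψ + d ∈ Q → inner ℝ c φ ≤ inner ℝ c ψ := by
  obtain ⟨φ₀, hφ₀, hφ₀Q⟩ := hne
  obtain ⟨ε, hε, hle⟩ := exists_mul_norm_le_inner_of_mem_interior hdual hβ₀
  have hLc : Continuous L := L.continuous_of_finiteDimensional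
  have hcl : IsClosed {φ : X | φ ∈ S ∧ L φ + d ∈ Q} :=
    S.closed_of_finiteDimensional.inter (hQ.preimage (hLc.add continuous_const))
  have hev : ∀ᶠ φ in cocompact X ⊓ 𝓟 {φ : X | φ ∈ S ∧ L φ + d ∈ Q},
      inner ℝ c φ₀ ≤ inner ℝ c φ := by
    rw [eventually_inf_principal]
    -- The cost equals `inner ℝ β₀ (L φ + d) - inner ℝ β₀ d`, hence grows at least like `ε * ‖L φ +
    -- d‖`; beyond this radius it exceeds the cost of `φ₀`.
    filter_upwards [(tendsto_norm_cocompact_atTop (E := X)).eventually_ge_atTop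
      (max m 1 * ((inner ℝ c φ₀ + inner ℝ β₀ d) / ε + ‖d‖))] with φ hφ ⟨hφS, hφQ⟩
    have hm : 0 < max m 1 := lt_of_lt_of_le one_pos (le_max_right _ _)
    have h1 : ‖φ‖ ≤ max m 1 * (‖L φ + d‖ + ‖d‖) := by
      refine (hS φ hφS).trans ?_
      gcongr
      · exact le_max_left _ _
      · have := norm_sub_le (L φ + d) d
        rwa [add_sub_cancel_right] at this
    have h2 := le_of_mul_le_mul_left (hφ.trans h1) hm
    have h3 : (inner ℝ c φ₀ + inner ℝ β₀ d) / ε ≤ ‖L φ + d‖ := by linarith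
    rw [div_le_iff₀ hε] at h3
    have h4 := hle _ hφQ
    rw [inner_add_right, ← hc φ] at h4
    linarith
  have hcont : Continuous fun φ : X => (inner ℝ c φ : ℝ) := by fun_prop
  obtain ⟨φ, hφ, hmin⟩ := hcont.continuousOn.exists_isMinOn' hcl ⟨hφ₀, hφ₀Q⟩ hev
  exact ⟨φ, hφ.1, hφ.2, fun ψ h1 h2 => hmin ⟨h1, h2⟩⟩

/-- Strong duality: under Slater's condition a minimizer of a conic program has a multiplier. -/
theorem exists_conic_multiplier [FiniteDimensional ℝ H] {L : X →ₗ[ℝ] H} {d : H} {Q : Set H}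
    (hconv : Convex ℝ Q) (hcone : ∀ s : ℝ, 0 ≤ s → ∀ z ∈ Q, s • z ∈ Q) {c : X} {φ φ₀ : X}
    (hφ₀ : L φ₀ + d ∈ interior Q) (hφ : L φ + d ∈ Q)
    (hmin : ∀ ψ, L ψ + d ∈ Q → inner ℝ c φ ≤ inner ℝ c ψ) :
    ∃ β : H, (∀ ψ, inner ℝ c ψ = inner ℝ β (L ψ)) ∧ (∀ z ∈ Q, 0 ≤ inner ℝ β z) ∧
      inner ℝ β (L φ + d) = 0 := by
  have hLc : Continuous L := L.continuous_of_finiteDimensional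
  set p : ℝ := inner ℝ c φ with hp
  -- Pairs of an excess value and a perturbation of the constraint. Using the interior of `Q` makes
  -- `T` open; minimality of `φ` keeps the origin outside, so a hyperplane separates them.
  set T : Set (ℝ × H) := {x | ∃ ψ, inner ℝ c ψ - p < x.1 ∧ L ψ + d - x.2 ∈ interior Q} with hT
  have hTopen : IsOpen T := by
    have : T = ⋃ ψ, {x : ℝ × H | inner ℝ c ψ - p < x.1 ∧ L ψ + d - x.2 ∈ interior Q} := by
      ext x; simp [hT]
    rw [this]
    refine isOpen_iUnion fun ψ => ?_
    exact (isOpen_lt continuous_const continuous_fst).inter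
      (isOpen_interior.preimage (continuous_const.sub continuous_snd))
  have hTconv : Convex ℝ T := by
    rintro x ⟨ψ, h1, h2⟩ y ⟨χ, h3, h4⟩ a b ha hb hab
    refine ⟨a • ψ + b • χ, ?_, ?_⟩
    · simp only [inner_add_right, real_inner_smul_right, Prod.fst_add, Prod.smul_fst, smul_eq_mul]
      have h5 : a * (inner ℝ c ψ - p - x.1) + b * (inner ℝ c χ - p - y.1) < 0 := by
        rcases ha.eq_or_lt with rfl | ha'
        · have : b = 1 := by linarith
          subst this; linarith
        · have := mul_neg_of_pos_of_neg ha' (sub_neg.2 h1)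
          have := mul_nonpos_of_nonneg_of_nonpos hb (sub_neg.2 h3).le
          linarith
      have h6 : p = a * p + b * p := by rw [← add_mul, hab, one_mul]
      linarith
    · have h5 := hconv.interior h2 h4 ha hb hab
      have h6 : L (a • ψ + b • χ) + d - (a • x + b • y).2
          = a • (L ψ + d - x.2) + b • (L χ + d - y.2) := by
        have h7 : d = a • d + b • d := by rw [← add_smul, hab, one_smul]
        simp only [map_add, map_smul, Prod.snd_add, Prod.smul_snd, smul_sub, smul_add]
        conv_lhs => rw [h7]
        abel
      rwa [h6]
  have h0 : (0 : ℝ × H) ∉ T := by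
    rintro ⟨ψ, h1, h2⟩
    simp only [Prod.fst_zero, Prod.snd_zero, sub_zero] at h1 h2
    have := hmin ψ (interior_subset h2)
    linarith
  obtain ⟨g, hg⟩ := geometric_hahn_banach_point_open hTconv hTopen h0
  rw [map_zero] at hg
  set a : ℝ := g (1, 0) with ha
  obtain ⟨b, hb⟩ : ∃ b : H, ∀ w, g (0, w) = inner ℝ b w :=
    ⟨(InnerProductSpace.toDual ℝ H).symm (g.comp (ContinuousLinearMap.inr ℝ ℝ H)), fun w => by
      simp⟩
  have hgab : ∀ t w, g (t, w) = t * a + inner ℝ b w := by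
    intro t w
    have : ((t, w) : ℝ × H) = t • (1, 0) + (0, w) := by simp
    rw [this, map_add, map_smul, hb, smul_eq_mul]
  -- Slater's condition: the hyperplane is not vertical, so it can be normalized to give a
  -- multiplier.
  have hapos : 0 < a := by
    have h1 : (|inner ℝ c φ₀ - p| + 1, (0 : H)) ∈ T :=
      ⟨φ₀, lt_of_le_of_lt (le_abs_self _) (lt_add_one _), by simpa using hφ₀⟩
    have h2 := hg _ h1
    rw [hgab, inner_zero_right, add_zero] at h2
    exact pos_of_mul_pos_right h2 (by positivity)
  have hint : ∀ ψ, ∀ z ∈ interior Q, 0 ≤ (inner ℝ c ψ - p) * a + inner ℝ b (L ψ + d - z) := by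
    intro ψ z hz
    refine le_of_forall_pos_le_add fun ε hε => ?_
    have h1 : ((inner ℝ c ψ - p + ε / a : ℝ), L ψ + d - z) ∈ T :=
      ⟨ψ, by simpa using div_pos hε hapos, by simpa using hz⟩
    have h2 := hg _ h1
    rw [hgab, add_mul, div_mul_cancel₀ _ hapos.ne'] at h2
    linarith
  have hall : ∀ ψ, ∀ z ∈ Q, 0 ≤ (inner ℝ c ψ - p) * a + inner ℝ b (L ψ + d - z) := by
    intro ψ z hz
    have h1 : z ∈ closure (interior Q) := by
      rw [hconv.closure_interior_eq_closure_of_nonempty_interior ⟨_, hφ₀⟩]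
      exact subset_closure hz
    have hcl : IsClosed {z : H | 0 ≤ (inner ℝ c ψ - p) * a + inner ℝ b (L ψ + d - z)} :=
      isClosed_le continuous_const (by fun_prop)
    exact closure_minimal (fun z hz => hint ψ z hz) hcl h1
  set β : H := -(a⁻¹ • b) with hβ
  have hβall : ∀ ψ, ∀ z ∈ Q, 0 ≤ inner ℝ c ψ - p - inner ℝ β (L ψ + d) + inner ℝ β z := by
    intro ψ z hz
    have h1 := hall ψ z hz
    rw [hβ, inner_neg_left, inner_neg_left, real_inner_smul_left, real_inner_smul_left]
    rw [inner_sub_right] at h1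
    have h2 : inner ℝ c ψ - p - -(a⁻¹ * inner ℝ b (L ψ + d)) + -(a⁻¹ * inner ℝ b z)
      = a⁻¹ * ((inner ℝ c ψ - p) * a + (inner ℝ b (L ψ + d) - inner ℝ b z)) := by
      field_simp
      ring
    rw [h2]
    exact mul_nonneg (inv_nonneg.2 hapos.le) h1
  have h0Q : (0 : H) ∈ Q := by simpa using hcone 0 le_rfl _ hφ
  have hβdual : ∀ z ∈ Q, 0 ≤ inner ℝ β z := by
    intro z hz
    by_contra! hneg
    set K : ℝ := inner ℝ c φ - p - inner ℝ β (L φ + d) with hK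
    -- A large multiple of an offending `z` would violate the inequality; the factor makes the
    -- pairing equal to `-(|K| + 1)`.
    have h1 := hβall φ (((|K| + 1) / (-(inner ℝ β z : ℝ))) • z)
      (hcone _ (div_nonneg (by positivity) (by linarith)) z hz)
    rw [real_inner_smul_right] at h1
    have h2 : (|K| + 1) / (-(inner ℝ β z : ℝ)) * inner ℝ β z = -(|K| + 1) := by
      have := hneg.ne
      field_simp
    rw [h2] at h1
    have := le_abs_self K
    linarith
  refine ⟨β, ?_, hβdual, ?_⟩
  -- A linear functional bounded below is zero; it is tested at multiples of `ψ` and of `-ψ`.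
  · have hlin : ∀ ψ, 0 ≤ inner ℝ c ψ - inner ℝ β (L ψ) := by
      intro ψ
      by_contra! hneg
      set κ : ℝ := inner ℝ c ψ - inner ℝ β (L ψ) with hκ
      set K : ℝ := p + inner ℝ β d with hK
      have h1 := hβall (((|K| + 1) / (-κ)) • ψ) 0 h0Q
      rw [map_smul, inner_zero_right, inner_add_right, real_inner_smul_right,
        real_inner_smul_right] at h1
      have h2 : (|K| + 1) / (-κ) * κ = -(|K| + 1) := by
        have := hneg.ne
        field_simp
      have h3 : (|K| + 1) / (-κ) * inner ℝ c ψ - (|K| + 1) / (-κ) * inner ℝ β (L ψ)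
        = -(|K| + 1) := by rw [← h2, hκ]; ring
      have := neg_abs_le K
      linarith
    intro ψ
    have h1 := hlin ψ
    have h2 := hlin (-ψ)
    rw [map_neg, inner_neg_right, inner_neg_right] at h2
    linarith
  · have h1 := hβall φ 0 h0Q
    rw [inner_zero_right] at h1
    have h2 := hβdual _ hφ
    linarith

end Conic

theorem exists_norm_le_mul_norm_map {X H : Type*} [NormedAddCommGroup X] [NormedSpace ℝ X]
    [FiniteDimensional ℝ X] [NormedAddCommGroup H] [NormedSpace ℝ H] (S : Submodule ℝ X)
    (L : X →ₗ[ℝ] H) (hL : ∀ x ∈ S, L x = 0 → x = 0) :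
    ∃ m : ℝ, 0 ≤ m ∧ ∀ x ∈ S, ‖x‖ ≤ m * ‖L x‖ := by
  have hker : LinearMap.ker (L ∘ₗ S.subtype) = ⊥ := by
    rw [LinearMap.ker_eq_bot']
    intro x hx
    exact Subtype.ext (hL x x.2 hx)
  obtain ⟨K, -, hK⟩ := (L ∘ₗ S.subtype).exists_antilipschitzWith hker
  refine ⟨K, K.2, fun x hx => ?_⟩
  have h := hK.le_mul_dist ⟨x, hx⟩ 0
  rw [map_zero, dist_zero_right, dist_zero_right] at h
  exact h

/-! ### Self-duality of the cone and properties of `BF` -/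

variable {D : ℕ} {n : Fin (D + 1) → ℕ}

/-- The entries of a vector of the cone space at a grid point, without the distinguished one. -/
noncomputable def tail (z : KSpace n) (i : SGrid n 0) :
    EuclideanSpace ℝ ((Fin D × Fin 4) ⊕ Unit) :=
  WithLp.toLp 2 fun k => z (Sum.inr k, i)

theorem tail_add (z w : KSpace n) (i : SGrid n 0) : tail (z + w) i = tail z i + tail w i := rfl

theorem tail_smul (s : ℝ) (z : KSpace n) (i : SGrid n 0) : tail (s • z) i = s • tail z i := rfl

theorem continuous_tail (i : SGrid n 0) : Continuous fun z : KSpace n => tail z i :=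
  (PiLp.continuous_toLp 2 _).comp (continuous_pi fun _ => by fun_prop)

theorem mem_coneQ {z : KSpace n} :
    z ∈ coneQ n ↔ ∀ i : SGrid n 0, ‖tail z i‖ ≤ z (Sum.inl (), i) := Iff.rfl

theorem inner_eq_sum_tail (z w : KSpace n) : inner ℝ z w =
    ∑ i : SGrid n 0, (z (Sum.inl (), i) * w (Sum.inl (), i) + inner ℝ (tail z i) (tail w i)) := by
  simp only [PiLp.inner_apply, tail, RCLike.inner_apply, conj_trivial]
  rw [Fintype.sum_prod_type_right]
  refine Finset.sum_congr rfl fun i _ => ?_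
  rw [Fintype.sum_sum_type]
  simp [mul_comm]

theorem isClosed_coneQ : IsClosed (coneQ n) := by
  have : coneQ n = ⋂ i : SGrid n 0, {z | ‖tail z i‖ ≤ z (Sum.inl (), i)} := by
    ext z; simp [mem_coneQ]
  rw [this]
  exact isClosed_iInter fun i => isClosed_le (continuous_tail i).norm (by fun_prop)

theorem smul_mem_coneQ (s : ℝ) (hs : 0 ≤ s) (z : KSpace n) (hz : z ∈ coneQ n) :
    s • z ∈ coneQ n := by
  rw [mem_coneQ] at hz ⊢
  intro i
  rw [tail_smul, norm_smul, Real.norm_eq_abs, abs_of_nonneg hs]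
  exact mul_le_mul_of_nonneg_left (hz i) hs

theorem convex_coneQ : Convex ℝ (coneQ n) := by
  intro z hz w hw a b ha hb _
  have h1 := mem_coneQ.1 (smul_mem_coneQ a ha z hz)
  have h2 := mem_coneQ.1 (smul_mem_coneQ b hb w hw)
  rw [mem_coneQ]
  intro i
  rw [tail_add]
  exact (norm_add_le _ _).trans (add_le_add (h1 i) (h2 i))

theorem zero_mem_coneQ : (0 : KSpace n) ∈ coneQ n := by
  rw [mem_coneQ]
  intro i
  have : tail (0 : KSpace n) i = 0 := rfl
  simp [this]

/-- Cauchy–Schwarz on the tails at each grid point. -/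
theorem inner_nonneg_of_mem_coneQ (z : KSpace n) (hz : z ∈ coneQ n) (w : KSpace n)
    (hw : w ∈ coneQ n) : 0 ≤ inner ℝ z w := by
  rw [inner_eq_sum_tail]
  refine Finset.sum_nonneg fun i _ => ?_
  have h1 := (abs_le.1 (abs_real_inner_le_norm (tail z i) (tail w i))).1
  have h2 := mul_le_mul (hz i) (hw i) (norm_nonneg _) ((norm_nonneg _).trans (hz i))
  have h3 : ‖tail z i‖ * ‖tail w i‖ ≤ z (Sum.inl (), i) * w (Sum.inl (), i) := h2
  linarith

theorem mem_interior_coneQ {z : KSpace n}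
    (hz : ∀ i : SGrid n 0, ‖tail z i‖ < z (Sum.inl (), i)) : z ∈ interior (coneQ n) := by
  refine mem_interior.2 ⟨⋂ i : SGrid n 0, {z | ‖tail z i‖ < z (Sum.inl (), i)}, ?_, ?_, ?_⟩
  · intro w hw
    rw [mem_coneQ]
    exact fun i => (Set.mem_iInter.1 hw i).le
  · exact isOpen_iInter_of_finite fun i => isOpen_lt (continuous_tail i).norm (by fun_prop)
  · exact Set.mem_iInter.2 hz

/-- The cone contains its dual cone. -/
theorem mem_coneQ_of_inner_nonneg {β : KSpace n} (h : ∀ z ∈ coneQ n, 0 ≤ inner ℝ β z) :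
    β ∈ coneQ n := by
  classical
  rw [mem_coneQ]
  intro i
  -- Extremal test vector, supported at `i`, whose tail is opposite to that of `β`.
  set w : KSpace n := WithLp.toLp 2 fun p => if p.2 = i then
    (match p.1 with
      | Sum.inl _ => ‖tail β i‖
      | Sum.inr k => -β (Sum.inr k, i)) else 0 with hw
  have hi : tail w i = -tail β i := by
    ext k; simp [tail, hw]
  have hj : ∀ j, j ≠ i → tail w j = 0 := fun j hj => by
    ext k; simp [tail, hw, hj]
  have hi' : w (Sum.inl (), i) = ‖tail β i‖ := by simp [hw]
  have hj' : ∀ j, j ≠ i → w (Sum.inl (), j) = 0 := fun j hj => by simp [hw, hj]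
  have hwQ : w ∈ coneQ n := by
    rw [mem_coneQ]
    intro j
    by_cases hji : j = i
    · subst hji; rw [hi, hi', norm_neg]
    · rw [hj j hji, hj' j hji, norm_zero]
  have h1 := h w hwQ
  rw [inner_eq_sum_tail, Finset.sum_eq_single i
    (fun j _ hji => by rw [hj j hji, hj' j hji]; simp) (by simp), hi, hi', inner_neg_right,
    real_inner_self_eq_norm_sq] at h1
  -- If the tail of `β` vanishes then so does `w`, and the unit vector of the distinguished
  -- coordinate is tested instead.
  rcases (norm_nonneg (tail β i)).eq_or_lt with h0 | h0
  · rw [← h0]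
    have := h (WithLp.toLp 2 fun p => if p = (Sum.inl (), i) then 1 else 0) (by
      rw [mem_coneQ]; intro j
      have : tail (n := n) (WithLp.toLp 2 fun p => if p = (Sum.inl (), i) then 1 else 0) j = 0 := by
        ext k; simp [tail]
      rw [this, norm_zero]
      show (0 : ℝ) ≤ if _ then 1 else 0
      split_ifs <;> norm_num)
    simpa [PiLp.inner_apply] using this
  · nlinarith

theorem BF_apply_inl (q : SSpace n) (i : SGrid n 0) : BF n q (Sum.inl (), i) = -q ⟨0, i⟩ := rfl

theorem BF_apply_mid (q : SSpace n) (d : Fin D) (v : Fin 4) (i : SGrid n 0) :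
    BF n q (Sum.inr (Sum.inl (d, v)), i) = √2 / 2 * shiftEntry q d v i := rfl

theorem BF_apply_last (q : SSpace n) (i : SGrid n 0) :
    BF n q (Sum.inr (Sum.inr ()), i) = q ⟨0, i⟩ := rfl

theorem up_down (j : CGrid n) (d : Fin (D + 1)) (h : 0 < (j d : ℕ)) :
    up (down j d) d (down_lt j d h) = j := by
  ext e
  by_cases he : e = d
  · subst he; simp [up, down]; omega
  · simp [up, down, Function.update_of_ne he]

/-- Every entry of `q` is copied somewhere. For a spatial component, the second shift reads all time
levels but the last, and the fourth shift, taken one level earlier, reads the last. -/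
theorem BF_injective (hn : ∀ d, 0 < n d) : Function.Injective (BF n) := by
  rw [← LinearMap.ker_eq_bot, LinearMap.ker_eq_bot']
  intro q hq
  have hmid : ∀ d v i, shiftEntry q d v i = 0 := fun d v i => by
    have h1 : BF n q (Sum.inr (Sum.inl (d, v)), i) = 0 := by rw [hq]; rfl
    rw [BF_apply_mid] at h1
    exact (mul_eq_zero.1 h1).resolve_left (by positivity)
  ext ⟨e, j, hj⟩
  refine Fin.cases (motive := fun e => ∀ (j : CGrid n) (hj : (j e : ℕ) < n e),
    q ⟨e, j, hj⟩ = 0) (fun j hj => ?_) (fun d j hj => ?_) e j hj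
  · have h1 : BF n q (Sum.inr (Sum.inr ()), ⟨j, hj⟩) = 0 := by rw [hq]; rfl
    rwa [BF_apply_last] at h1
  · by_cases h0 : (j 0 : ℕ) < n 0
    · have h1 := hmid d 1 ⟨j, h0⟩
      simpa [shiftEntry, hj] using h1
    · have hpos : 0 < (j 0 : ℕ) := by have := hn 0; omega
      have h1 := hmid d 3 ⟨down j 0, down_lt j 0 hpos⟩
      have h2 : ((down j 0) d.succ : ℕ) < n d.succ := by
        simpa [down, Function.update_of_ne (Fin.succ_ne_zero d)] using hj
      simp only [shiftEntry] at h1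
      rw [dif_pos h2] at h1
      rw [← h1]
      exact congrArg (fun i : SGrid n d.succ => q ⟨d.succ, i⟩) (Subtype.ext (up_down j 0 hpos).symm)

/-- The first and last coordinates cancel. Multiples of `shiftVec n` can thus be added to a dual
vector without changing its image under the adjoint of `BF n`. -/
theorem inner_shiftVec_BF (q : SSpace n) : inner ℝ (shiftVec n) (BF n q) = 0 := by
  have h : ∀ i, inner ℝ (tail (shiftVec n) i) (tail (BF n q) i) = q ⟨0, i⟩ := fun i => by
    simp [PiLp.inner_apply, tail, shiftVec, BF_apply_last]
  rw [inner_eq_sum_tail]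
  refine Finset.sum_eq_zero fun i _ => ?_
  rw [h, BF_apply_inl]
  simp [shiftVec]

/-- A positive density can be lifted to a point in the interior of the cone. -/
theorem exists_mem_interior_coneQ (hn : ∀ d, 0 < n d) (α : SSpace n)
    (hα : ∀ i, 0 < α ⟨0, i⟩) :
    ∃ β ∈ interior (coneQ n), ∀ q, inner ℝ β (BF n q) = -inner ℝ α q := by
  classical
  obtain ⟨β, hβ⟩ : ∃ β, LinearMap.adjoint (BF n) β = -α := by
    have h1 : LinearMap.range (LinearMap.adjoint (BF n)) = ⊤ := by
      rw [← LinearMap.orthogonal_ker, LinearMap.ker_eq_bot.2 (BF_injective hn),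
        Submodule.bot_orthogonal_eq_top]
    exact LinearMap.range_eq_top.1 h1 (-α)
  have hβ' : ∀ q, inner ℝ β (BF n q) = -inner ℝ α q := fun q => by
    rw [← LinearMap.adjoint_inner_left, hβ, inner_neg_left]
  have hdiff : ∀ i, α ⟨0, i⟩ = β (Sum.inl (), i) - β (Sum.inr (Sum.inr ()), i) := fun i => by
    have h1 := hβ' (WithLp.toLp 2 fun p => if p = ⟨0, i⟩ then 1 else 0)
    have hmid : ∀ d v j, shiftEntry (n := n)
        (WithLp.toLp 2 fun p => if p = ⟨0, i⟩ then 1 else 0) d v j = 0 := fun d v j => by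
      have h0 : ∀ (x : SGrid n d.succ),
          ((⟨d.succ, x⟩ : Σ d : Fin (D + 1), SGrid n d) = ⟨0, i⟩) ↔ False := fun x => by
        simp only [iff_false]
        intro h
        exact Fin.succ_ne_zero d (congrArg Sigma.fst h)
      fin_cases v <;> simp [shiftEntry, h0]
    have h2 : ∀ j, inner ℝ (tail β j) (tail (BF n
        (WithLp.toLp 2 fun p => if p = ⟨0, i⟩ then 1 else 0)) j)
        = β (Sum.inr (Sum.inr ()), j) * if j = i then 1 else 0 := fun j => by
      simp only [PiLp.inner_apply, tail, RCLike.inner_apply, conj_trivial, Fintype.sum_sum_type,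
        Finset.univ_unique, Finset.sum_singleton]
      rw [Finset.sum_eq_zero fun l _ => by rw [BF_apply_mid, hmid, mul_zero, zero_mul], zero_add]
      change BF n _ (Sum.inr (Sum.inr ()), j) * β (Sum.inr (Sum.inr ()), j) = _
      rw [BF_apply_last]
      simp [mul_comm]
    rw [inner_eq_sum_tail] at h1
    simp only [h2, BF_apply_inl] at h1
    simp [PiLp.inner_apply, Finset.sum_add_distrib] at h1
    linarith
  -- Adding `s • shiftVec n` moves the first and last coordinates to `x + s` and `y + s`. The
  -- difference of their squares is `(x - y) * (x + y + 2 * s)`, which outgrows the fixed middle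
  -- block because `x - y` is the positive density.
  have hev : ∀ᶠ s : ℝ in atTop, ∀ i, ‖tail (β + s • shiftVec n) i‖
      < (β + s • shiftVec n) (Sum.inl (), i) := by
    rw [eventually_all]
    intro i
    have hn2 : ∀ s : ℝ, ‖tail (β + s • shiftVec n) i‖ ^ 2
        = ∑ l, β (Sum.inr (Sum.inl l), i) ^ 2 + (β (Sum.inr (Sum.inr ()), i) + s) ^ 2 := by
      intro s
      rw [EuclideanSpace.norm_sq_eq, Fintype.sum_sum_type]
      simp [tail, shiftVec]
    set B := ∑ l, β (Sum.inr (Sum.inl l), i) ^ 2 with hB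
    set x := β (Sum.inl (), i) with hx
    set y := β (Sum.inr (Sum.inr ()), i) with hy
    have hxy : 0 < x - y := by rw [← hdiff]; exact hα i
    filter_upwards [eventually_ge_atTop (-x), eventually_gt_atTop ((B / (x - y) - x - y) / 2)]
      with s h1 h2
    have e : (β + s • shiftVec n) (Sum.inl (), i) = x + s := by simp [shiftVec, hx]
    rw [e]
    refine lt_of_pow_lt_pow_left₀ 2 (by linarith) ?_
    rw [hn2]
    have h5 : B / (x - y) < x + s + (y + s) := by
      linarith
    rw [div_lt_iff₀ hxy] at h5
    nlinarith
  obtain ⟨s, hs⟩ := hev.exists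
  refine ⟨β + s • shiftVec n, mem_interior_coneQ hs, fun q => ?_⟩
  rw [inner_add_left, real_inner_smul_left, inner_shiftVec_BF, mul_zero, add_zero, hβ']

theorem gradOp_apply (φ : CSpace n) (p : Σ d : Fin (D + 1), SGrid n d) :
    gradOp n φ p = (n p.1 : ℝ) * (φ (up p.2.1 p.1 p.2.2) - φ p.2.1) := rfl

/-! ### Total mass -/

theorem exists_mem_cell (hn : ∀ d, 0 < n d) (y : Cube D) : ∃ i : XGrid n, y ∈ cell n i := by
  have hy0 : ∀ d, 0 ≤ y.1 d := fun d => y.2.1 d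
  have hy1 : ∀ d, y.1 d ≤ 1 := fun d => y.2.2 d
  have hnp : ∀ d : Fin D, (0 : ℝ) < n d.succ := fun d => by exact_mod_cast hn d.succ
  have hnn : ∀ d : Fin D, 0 ≤ y.1 d * n d.succ + 1 / 2 := fun d => by
    have := mul_nonneg (hy0 d) (hnp d).le
    linarith
  -- Rounding to the nearest grid point.
  refine ⟨fun d => ⟨⌊y.1 d * n d.succ + 1 / 2⌋₊, ?_⟩, fun d => ?_⟩
  · rw [Nat.floor_lt (hnn d)]
    push_cast
    have := mul_le_mul_of_nonneg_right (hy1 d) (hnp d).le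
    linarith
  · have h1 := Nat.floor_le (hnn d)
    have h2 := Nat.lt_floor_add_one (y.1 d * n d.succ + 1 / 2)
    set k : ℝ := (⌊y.1 d * n d.succ + 1 / 2⌋₊ : ℝ) with hk
    have hn' := hnp d
    have e : k * (1 / (n d.succ : ℝ)) - y.1 d = (k - y.1 d * n d.succ) / n d.succ := by
      field_simp
    change |k * (1 / (n d.succ : ℝ)) - y.1 d| ≤ _
    rw [e, abs_div, abs_of_pos hn', div_right_comm]
    gcongr
    rw [abs_le]
    constructor <;> linarith

theorem sum_cell_pos (hn : ∀ d, 0 < n d) (ρ : Measure (Cube D)) [IsFiniteMeasure ρ] (hρ : ρ ≠ 0) :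
    0 < ∑ j : XGrid n, ρ.real (cell n j) := by
  refine (Finset.sum_nonneg fun j _ => measureReal_nonneg).lt_of_ne' fun h => hρ ?_
  rw [Finset.sum_eq_zero_iff_of_nonneg fun j _ => measureReal_nonneg] at h
  rw [← Measure.measure_univ_eq_zero, ← nonpos_iff_eq_zero]
  have hU : (Set.univ : Set (Cube D)) ⊆ ⋃ j : XGrid n, cell n j := fun y _ =>
    Set.mem_iUnion.2 (exists_mem_cell hn y)
  refine (measure_mono hU).trans ((measure_iUnion_le _).trans ?_)
  rw [tsum_fintype, Finset.sum_eq_zero]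
  exact fun j hj => (measureReal_eq_zero_iff).1 (h j hj)

/-- The total does not depend on `ρ`, even though neighbouring cells overlap: this is the mass
balance between the two marginals. -/
theorem sum_discreteDensity (hn : ∀ d, 0 < n d) (ρ : Measure (Cube D)) [IsFiniteMeasure ρ]
    (hρ : ρ ≠ 0) :
    ∑ i : XGrid n, discreteDensity n ρ i = (∏ d : Fin D, (1 / (n d.succ : ℝ)))⁻¹ := by
  unfold discreteDensity
  rw [← Finset.sum_div, ← Finset.sum_mul]
  have := (sum_cell_pos hn ρ hρ).ne'
  rw [← div_div, div_self this, one_div]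

theorem sum_cGrid (F : CGrid n → ℝ) :
    ∑ i, F i = ∑ t : Fin (n 0 + 1), ∑ x : XGrid n, F (Fin.cons t x) := by
  rw [← Fintype.sum_prod_type', ← (Fin.consEquiv fun e => Fin (n e + 1)).sum_comp]
  rfl

theorem inner_costVec (hn : ∀ d, 0 < n d) (ρ₀ ρ₁ : Measure (Cube D)) [IsFiniteMeasure ρ₀]
    [IsFiniteMeasure ρ₁] (hρ₀ : ρ₀ ≠ 0) (hρ₁ : ρ₁ ≠ 0) (φ : CSpace n) (g : Fin (n 0 + 1) → ℝ)
    (hg : ∀ i, φ i = g (i 0)) :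
    inner ℝ (costVec n ρ₀ ρ₁) φ
      = (∏ d : Fin D, (1 / (n d.succ : ℝ)))⁻¹ * (g 0 - g (Fin.last _)) := by
  have h0 := hn 0
  have h1 : ∀ t : Fin (n 0 + 1), ∑ x : XGrid n, costVec n ρ₀ ρ₁ (Fin.cons t x) * g t
      = (if t = 0 then (∑ x, discreteDensity n ρ₀ x) * g t else 0)
        + (if t = Fin.last _ then -(∑ x, discreteDensity n ρ₁ x) * g t else 0) := by
    intro t
    rw [← Finset.sum_mul]
    simp only [costVec, Fin.cons_zero, Fin.cons_succ]
    by_cases ht : t = 0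
    · subst ht
      have : (0 : Fin (n 0 + 1)) ≠ Fin.last _ := by
        intro h
        have := congrArg Fin.val h
        simp at this
        omega
      simp [this]
    · have ht' : (t : ℕ) ≠ 0 := fun h => ht (Fin.ext h)
      by_cases hl : t = Fin.last _
      · subst hl
        simp [h0.ne', ht]
      · have hl' : (t : ℕ) ≠ n 0 := fun h => hl (Fin.ext h)
        simp [ht, hl, ht', hl']
  have h2 : inner ℝ (costVec n ρ₀ ρ₁) φ = ∑ i, costVec n ρ₀ ρ₁ i * g (i 0) := by
    rw [PiLp.inner_apply]
    exact Finset.sum_congr rfl fun i _ => by simp [hg, mul_comm]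
  rw [h2, sum_cGrid]
  simp only [Fin.cons_zero, h1]
  rw [Finset.sum_add_distrib]
  simp only [Finset.sum_ite_eq', Finset.mem_univ, if_true]
  rw [sum_discreteDensity hn ρ₀ hρ₀, sum_discreteDensity hn ρ₁ hρ₁]
  ring

/-! ### The continuity equation -/

/-- A point of the staggered grid in time is a time interval and a spatial grid point. -/
def sGridZeroEquiv : SGrid n 0 ≃ Fin (n 0) × XGrid n where
  toFun i := (⟨i.1 0, i.2⟩, fun d => i.1 d.succ)
  invFun p := ⟨Fin.cons p.1.castSucc p.2, by simp⟩
  left_inv i := by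
    apply Subtype.ext
    funext e
    refine Fin.cases ?_ (fun d => ?_) e <;> simp
  right_inv p := by simp

theorem sum_time_difference (g : Fin (n 0 + 1) → ℝ) :
    ∑ i : SGrid n 0, (g ((up i.1 0 i.2) 0) - g (i.1 0))
      = Fintype.card (XGrid n) * (g (Fin.last _) - g 0) := by
  rw [← (sGridZeroEquiv (n := n)).symm.sum_comp, Fintype.sum_prod_type_right]
  have h : ∀ x : XGrid n, ∑ t : Fin (n 0), (g ((up (sGridZeroEquiv.symm (t, x)).1 0
      (sGridZeroEquiv.symm (t, x)).2) 0) - g ((sGridZeroEquiv.symm (t, x)).1 0))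
      = g (Fin.last _) - g 0 := by
    intro x
    have h1 : ∀ t : Fin (n 0), g ((up (sGridZeroEquiv.symm (t, x)).1 0
      (sGridZeroEquiv.symm (t, x)).2) 0) = g t.succ := fun t => by
        simp only [up, sGridZeroEquiv, Function.update_self]
        rfl
    have h2 : ∀ t : Fin (n 0), g ((sGridZeroEquiv.symm (t, x)).1 0) = g t.castSucc := fun t => by
        simp [sGridZeroEquiv]
    simp only [h1, h2]
    rw [Finset.sum_sub_distrib]
    have h3 := Fin.sum_univ_succ g
    have h4 := Fin.sum_univ_castSucc g
    linarith
  rw [Finset.sum_congr rfl fun x _ => h x, Finset.sum_const, nsmul_eq_mul]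
  rfl

theorem down_apply_of_ne (i : CGrid n) (d e : Fin (D + 1)) (h : e ≠ d) : down i d e = i e := by
  simp [down, Function.update_of_ne h]

/-- A grid function without spatial differences depends on time only. -/
theorem eq_of_spatial_const (φ : CSpace n)
    (h : ∀ (d : Fin D) (i : CGrid n) (hi : (i d.succ : ℕ) < n d.succ), φ (up i d.succ hi) = φ i)
    (i : CGrid n) : φ i = φ (Fin.cons (i 0) 0) := by
  induction hm : ∑ d : Fin D, (i d.succ : ℕ) using Nat.strong_induction_on generalizing i with
  | _ m ih =>
    by_cases hall : ∀ d : Fin D, (i d.succ : ℕ) = 0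
    · refine congrArg φ (funext fun e => ?_)
      refine Fin.cases (by simp) (fun d => ?_) e
      rw [Fin.cons_succ]
      exact Fin.ext (hall d)
    · push Not at hall
      obtain ⟨d, hd⟩ := hall
      have hpos : 0 < (i d.succ : ℕ) := Nat.pos_of_ne_zero hd
      have h1 := h d (down i d.succ) (down_lt _ _ hpos)
      rw [up_down i d.succ hpos] at h1
      have hlt : ∑ e : Fin D, (down i d.succ e.succ : ℕ) < m := by
        rw [← hm]
        refine Finset.sum_lt_sum (fun e _ => ?_) ⟨d, Finset.mem_univ _, ?_⟩
        · by_cases hed : e = d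
          · subst hed; simp [down]
          · rw [down_apply_of_ne _ _ _ fun h => hed (Fin.succ_injective _ h)]
        · simp only [down, Function.update_self]; omega
      have h2 := ih _ hlt (down i d.succ) rfl
      rw [h1, h2, down_apply_of_ne _ _ _ (Fin.succ_ne_zero d).symm]

/-- The projection that removes the time component. -/
noncomputable def spatialProj (n : Fin (D + 1) → ℕ) : SSpace n →ₗ[ℝ] SSpace n where
  toFun q := WithLp.toLp 2 fun p => if p.1 = 0 then 0 else q p
  map_add' q r := by
    ext p
    by_cases h : p.1 = 0 <;> simp [h]
  map_smul' a q := by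
    ext p
    by_cases h : p.1 = 0 <;> simp [h]

theorem spatialProj_apply (q : SSpace n) (p : Σ d : Fin (D + 1), SGrid n d) :
    spatialProj n q p = if p.1 = 0 then 0 else q p := rfl

theorem inner_spatialProj (q r : SSpace n) :
    inner ℝ (spatialProj n q) r = inner ℝ q (spatialProj n r) := by
  rw [PiLp.inner_apply, PiLp.inner_apply]
  refine Finset.sum_congr rfl fun p _ => ?_
  rw [spatialProj_apply, spatialProj_apply]
  by_cases h : p.1 = 0 <;> simp [h]

/-- The discrete continuity equation has a solution with positive density. -/
theorem exists_pos_density (hn : ∀ d, 0 < n d) (ρ₀ ρ₁ : Measure (Cube D)) [IsFiniteMeasure ρ₀]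
    [IsFiniteMeasure ρ₁] (hρ₀ : ρ₀ ≠ 0) (hρ₁ : ρ₁ ≠ 0) :
    ∃ α : SSpace n, LinearMap.adjoint (gradOp n) α = -costVec n ρ₀ ρ₁ ∧
      ∀ i, 0 < α ⟨0, i⟩ := by
  have hnr : ∀ d, (0 : ℝ) < n d := fun d => by exact_mod_cast hn d
  set P : ℝ := (∏ d : Fin D, (1 / (n d.succ : ℝ)))⁻¹ with hP
  have hPpos : 0 < P := inv_pos.2 (Finset.prod_pos fun d _ => one_div_pos.2 (hnr _))
  set K : ℝ := (Fintype.card (XGrid n) : ℝ) with hK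
  have hKpos : 0 < K := by
    rw [hK]; exact_mod_cast Fintype.card_pos
  -- The constant density carrying the total mass prescribed by the cost vector.
  set κ : ℝ := P / (n 0 * K) with hκ
  have hκpos : 0 < κ := div_pos hPpos (mul_pos (hnr 0) hKpos)
  set α₀ : SSpace n := WithLp.toLp 2 fun p => if p.1 = 0 then κ else 0 with hα₀
  set T := spatialProj n ∘ₗ gradOp n with hT
  -- What remains is to be balanced by spatial fluxes alone. This is possible when it is orthogonal
  -- to the kernel of the spatial gradient, that is, to functions of time only; there the sums
  -- telescope and mass balance gives zero.
  have hr : -costVec n ρ₀ ρ₁ - LinearMap.adjoint (gradOp n) α₀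
      ∈ LinearMap.range (LinearMap.adjoint T) := by
    rw [← LinearMap.orthogonal_ker, Submodule.mem_orthogonal']
    intro φ hφ
    have hφ' : ∀ (d : Fin D) (i : CGrid n) (hi : (i d.succ : ℕ) < n d.succ),
        φ (up i d.succ hi) = φ i := by
      intro d i hi
      have h1 : T φ ⟨d.succ, i, hi⟩ = 0 := by rw [LinearMap.mem_ker.1 hφ]; rfl
      rw [hT, LinearMap.comp_apply, spatialProj_apply, if_neg (Fin.succ_ne_zero d),
        gradOp_apply] at h1
      exact sub_eq_zero.1 ((mul_eq_zero.1 h1).resolve_left (hnr _).ne')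
    set g : Fin (n 0 + 1) → ℝ := fun t => φ (Fin.cons t 0) with hg
    have hφg : ∀ i, φ i = g (i 0) := eq_of_spatial_const φ hφ'
    rw [inner_sub_left, inner_neg_left, LinearMap.adjoint_inner_left,
      inner_costVec hn ρ₀ ρ₁ hρ₀ hρ₁ φ g hφg]
    have h2 : inner ℝ α₀ (gradOp n φ) = κ * n 0 * (K * (g (Fin.last _) - g 0)) := by
      rw [hK, ← sum_time_difference g, PiLp.inner_apply, Fintype.sum_sigma,
        Finset.sum_eq_single 0 (fun d _ hd => Finset.sum_eq_zero fun i _ => by simp [hα₀, hd])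
          (by simp), Finset.mul_sum]
      refine Finset.sum_congr rfl fun i _ => ?_
      rw [gradOp_apply, ← hφg, ← hφg]
      simp [hα₀]
      ring
    rw [h2, hκ]
    have := (hnr 0).ne'
    have := hKpos.ne'
    field_simp
    ring
  obtain ⟨y, hy⟩ := hr
  refine ⟨α₀ + spatialProj n y, ?_, fun i => ?_⟩
  · have h1 : LinearMap.adjoint (gradOp n) (spatialProj n y) = LinearMap.adjoint T y := by
      refine ext_inner_right ℝ fun φ => ?_
      rw [LinearMap.adjoint_inner_left, LinearMap.adjoint_inner_left, inner_spatialProj]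
      rfl
    rw [map_add, h1, hy]
    abel
  · have : (α₀ + spatialProj n y) ⟨0, i⟩ = κ := by
      rw [PiLp.add_apply, spatialProj_apply]
      simp [hα₀]
    rw [this]
    exact hκpos

/-! ### Strict feasibility and existence of a KKT point -/

/-- Slater's condition. -/
theorem exists_strictly_feasible (hn : ∀ d, 0 < n d) :
    ∃ φ : CSpace n, BF n (gradOp n φ) + shiftVec n ∈ interior (coneQ n) := by
  have hnr : ∀ d, (n d : ℝ) ≠ 0 := fun d => by exact_mod_cast (hn d).ne'
  -- Minus the time variable: its image under the affine map is `(2; 0; …; 0)`.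
  set φ : CSpace n := WithLp.toLp 2 fun i => -((i 0 : ℕ) : ℝ) / n 0 with hφ
  have h0 : ∀ i, gradOp n φ ⟨0, i⟩ = -1 := fun i => by
    rw [gradOp_apply]
    have := hnr 0
    simp only [hφ, up, Function.update_self]
    push_cast
    field_simp
    ring
  have hd : ∀ (d : Fin D) i, gradOp n φ ⟨d.succ, i⟩ = 0 := fun d i => by
    rw [gradOp_apply]
    simp only [hφ]
    rw [up_apply_of_ne _ _ _ _ (Fin.succ_ne_zero d).symm, sub_self, mul_zero]
  have hs : ∀ d v i, shiftEntry (gradOp n φ) d v i = 0 := fun d v i => by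
    fin_cases v <;> simp [shiftEntry, hd]
  refine ⟨φ, mem_interior_coneQ fun i => ?_⟩
  have ht : tail (BF n (gradOp n φ) + shiftVec n) i = 0 := by
    ext k
    rcases k with ⟨d, v⟩ | _
    · change BF n (gradOp n φ) (Sum.inr (Sum.inl (d, v)), i) + 0 = 0
      rw [BF_apply_mid, hs, mul_zero, add_zero]
    · change BF n (gradOp n φ) (Sum.inr (Sum.inr ()), i) + 1 = 0
      rw [BF_apply_last, h0]; norm_num
  rw [ht, norm_zero]
  change 0 < BF n (gradOp n φ) (Sum.inl (), i) + 1
  rw [BF_apply_inl, h0]; norm_num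

/-- The range of the adjoint is the orthogonal complement of the kernel. -/
theorem eq_zero_of_mem_rgeAdj {φ : CSpace n} (hφ : φ ∈ rgeAdj n) (h : gradOp n φ = 0) : φ = 0 := by
  rw [rgeAdj, ← LinearMap.orthogonal_ker] at hφ
  exact inner_self_eq_zero.1 (hφ φ (LinearMap.mem_ker.2 h))

theorem exists_mem_rgeAdj (φ : CSpace n) : ∃ ψ ∈ rgeAdj n, gradOp n ψ = gradOp n φ := by
  obtain ⟨y, hy⟩ : gradOp n φ ∈ LinearMap.range (gradOp n ∘ₗ LinearMap.adjoint (gradOp n)) := by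
    rw [LinearMap.range_self_comp_adjoint]; exact ⟨φ, rfl⟩
  exact ⟨_, ⟨y, rfl⟩, hy⟩

/-- The KKT system has a solution. -/
theorem exists_isRestrictedKKT (hn : ∀ d, 0 < n d) (ρ₀ ρ₁ : Measure (Cube D)) [IsFiniteMeasure ρ₀]
    [IsFiniteMeasure ρ₁] (hρ₀ : ρ₀ ≠ 0) (hρ₁ : ρ₁ ≠ 0) :
    ∃ φ z q α β, IsRestrictedKKT n (costVec n ρ₀ ρ₁) φ z q α β := by
  obtain ⟨α₀, hα₀, hpos⟩ := exists_pos_density hn ρ₀ ρ₁ hρ₀ hρ₁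
  obtain ⟨β₀, hβ₀, hβα⟩ := exists_mem_interior_coneQ hn α₀ hpos
  obtain ⟨φ₀, hφ₀⟩ := exists_strictly_feasible hn
  set c := costVec n ρ₀ ρ₁ with hc
  set L := BF n ∘ₗ gradOp n with hL
  have hcβ : ∀ φ, inner ℝ c φ = inner ℝ β₀ (L φ) := fun φ => by
    rw [hL, LinearMap.comp_apply, hβα, ← LinearMap.adjoint_inner_left, hα₀, inner_neg_left, neg_neg]
  obtain ⟨m, -, hm⟩ := exists_norm_le_mul_norm_map (rgeAdj n) L fun φ hφ h0 =>
    eq_zero_of_mem_rgeAdj hφ (BF_injective hn (by rw [map_zero]; exact h0))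
  obtain ⟨ψ₀, hψ₀, hψφ⟩ := exists_mem_rgeAdj φ₀
  obtain ⟨φ, hφ, hφQ, hmin⟩ := exists_conic_min (d := shiftVec n) isClosed_coneQ
    inner_nonneg_of_mem_coneQ hβ₀ hcβ hm
    ⟨ψ₀, hψ₀, by
      rw [hL, LinearMap.comp_apply, hψφ]; exact interior_subset hφ₀⟩
  -- The minimizer over `rgeAdj n` is a global one: cost and constraint depend on `φ` only through
  -- its gradient, and every gradient is attained in `rgeAdj n`.
  obtain ⟨β, h1, h2, h3⟩ := exists_conic_multiplier (L := L) (d := shiftVec n) (c := c) (φ := φ)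
    convex_coneQ smul_mem_coneQ hφ₀ hφQ fun ψ hψ => by
      obtain ⟨χ, hχ, hχψ⟩ := exists_mem_rgeAdj ψ
      have e : L χ = L ψ := by rw [hL, LinearMap.comp_apply, hχψ]; rfl
      rw [hcβ ψ, ← e, ← hcβ χ]
      exact hmin χ hχ (by rw [e]; exact hψ)
  refine ⟨φ, L φ + shiftVec n, gradOp n φ, -LinearMap.adjoint (BF n) β, β, ⟨⟨sub_self _, ?_, ?_,
    neg_add_cancel _, hφQ, mem_coneQ_of_inner_nonneg h2, by rw [real_inner_comm]; exact h3⟩, hφ⟩⟩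
  · rw [hL, LinearMap.comp_apply]; abel
  · refine ext_inner_right ℝ fun ψ => ?_
    rw [inner_add_left, LinearMap.adjoint_inner_left, inner_neg_left, LinearMap.adjoint_inner_left,
      h1 ψ, inner_zero_left]
    exact neg_add_cancel _

/-! ### The algorithm as an alternating direction method -/

/-- The feasible set `rge(A*) × Q` of the first block. -/
def feasSet (n : Fin (D + 1) → ℕ) : Set (CSpace n × KSpace n) :=
  {u | u.1 ∈ rgeAdj n ∧ u.2 ∈ coneQ n}

/-- The linear objective `⟨c, φ⟩`. -/
noncomputable def costFun (c : CSpace n) : CSpace n × KSpace n →ₗ[ℝ] ℝ :=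
  innerₛₗ ℝ c ∘ₗ LinearMap.fst ℝ _ _

/-- The operator `(φ, z) ↦ (A φ, z)`. -/
noncomputable def firstOp (n : Fin (D + 1) → ℕ) :
    CSpace n × KSpace n →ₗ[ℝ] WithLp 2 (SSpace n × KSpace n) :=
  (WithLp.linearEquiv 2 ℝ (SSpace n × KSpace n)).symm.toLinearMap ∘ₗ
    (gradOp n).prodMap LinearMap.id

/-- The operator `q ↦ (q, B F q)`. -/
noncomputable def secondOp (n : Fin (D + 1) → ℕ) :
    SSpace n →ₗ[ℝ] WithLp 2 (SSpace n × KSpace n) :=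
  (WithLp.linearEquiv 2 ℝ (SSpace n × KSpace n)).symm.toLinearMap ∘ₗ
    LinearMap.id.prod (BF n)

/-- The right-hand side `(0, d)` of the constraints. -/
noncomputable def rhsVec (n : Fin (D + 1) → ℕ) : WithLp 2 (SSpace n × KSpace n) :=
  WithLp.toLp 2 (0, shiftVec n)

theorem firstOp_apply (u : CSpace n × KSpace n) :
    firstOp n u = WithLp.toLp 2 (gradOp n u.1, u.2) := rfl

theorem secondOp_apply (q : SSpace n) : secondOp n q = WithLp.toLp 2 (q, BF n q) := rfl

theorem costFun_apply (c : CSpace n) (u : CSpace n × KSpace n) :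
    costFun c u = inner ℝ c u.1 := rfl

theorem residual_eq (φ : CSpace n) (z : KSpace n) (q : SSpace n) :
    firstOp n (φ, z) - secondOp n q - rhsVec n
      = WithLp.toLp 2 (gradOp n φ - q, z - BF n q - shiftVec n) := by
  rw [firstOp_apply, secondOp_apply, rhsVec, ← WithLp.toLp_sub, ← WithLp.toLp_sub]
  simp

theorem isClosed_feasSet : IsClosed (feasSet n) :=
  ((rgeAdj n).closed_of_finiteDimensional.preimage continuous_fst).inter
    (isClosed_coneQ.preimage continuous_snd)

theorem convex_feasSet : Convex ℝ (feasSet n) := fun _ hu _ hv _ _ ha hb hab =>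
  ⟨(rgeAdj n).convex hu.1 hv.1 ha hb hab, convex_coneQ hu.2 hv.2 ha hb hab⟩

theorem exists_norm_le_firstOp : ∃ m : ℝ, ∀ u ∈ feasSet n, ∀ v ∈ feasSet n,
    ‖u - v‖ ≤ m * ‖firstOp n (u - v)‖ := by
  obtain ⟨m, hm0, hm⟩ := exists_norm_le_mul_norm_map (rgeAdj n) (gradOp n)
    fun φ => eq_zero_of_mem_rgeAdj
  refine ⟨max m 1, fun u hu v hv => ?_⟩
  have hsq := WithLp.prod_norm_sq_eq_of_L2 (firstOp n (u - v))
  have h1 : ‖gradOp n (u - v).1‖ ≤ ‖firstOp n (u - v)‖ :=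
    le_of_sq_le_sq (by rw [hsq]; exact le_add_of_nonneg_right (sq_nonneg _)) (norm_nonneg _)
  have h2 : ‖(u - v).2‖ ≤ ‖firstOp n (u - v)‖ :=
    le_of_sq_le_sq (by rw [hsq]; exact le_add_of_nonneg_left (sq_nonneg _)) (norm_nonneg _)
  rw [Prod.norm_def]
  refine max_le ?_ ?_
  · refine (hm _ ((rgeAdj n).sub_mem hu.1 hv.1)).trans ?_
    exact mul_le_mul (le_max_left _ _) h1 (norm_nonneg _) (hm0.trans (le_max_left _ _))
  · exact h2.trans (le_mul_of_one_le_left (norm_nonneg _) (le_max_right _ _))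

theorem norm_le_secondOp (q : SSpace n) : ‖q‖ ≤ 1 * ‖secondOp n q‖ := by
  have hsq := WithLp.prod_norm_sq_eq_of_L2 (secondOp n q)
  rw [one_mul]
  exact le_of_sq_le_sq (by rw [hsq]; exact le_add_of_nonneg_right (sq_nonneg _)) (norm_nonneg _)

theorem inner_secondOp (α q : SSpace n) (β : KSpace n) :
    inner ℝ (WithLp.toLp 2 (α, β) : WithLp 2 (SSpace n × KSpace n)) (secondOp n q)
      = inner ℝ (α + LinearMap.adjoint (BF n) β) q := by
  rw [inner_add_left, LinearMap.adjoint_inner_left, secondOp_apply, WithLp.prod_inner_apply]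

theorem inner_firstOp (α : SSpace n) (β : KSpace n) (u : CSpace n × KSpace n) :
    inner ℝ (WithLp.toLp 2 (α, β) : WithLp 2 (SSpace n × KSpace n)) (firstOp n u)
      = inner ℝ (LinearMap.adjoint (gradOp n) α) u.1 + inner ℝ β u.2 := by
  rw [LinearMap.adjoint_inner_left, firstOp_apply, WithLp.prod_inner_apply]

theorem IsRestrictedKKT.isSaddle {c φ : CSpace n} {z : KSpace n} {q α : SSpace n} {β : KSpace n}
    (h : IsRestrictedKKT n c φ z q α β) :
    IsSaddle (feasSet n) (costFun c) (firstOp n) (secondOp n) (rhsVec n) (φ, z) q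
      (WithLp.toLp 2 (α, β)) := by
  refine ⟨⟨h.φ_mem, h.z_mem⟩, ?_, fun v => ?_, fun u hu => ?_⟩
  · rw [residual_eq, h.primal_q, h.primal_z]; rfl
  · rw [inner_secondOp, h.dual_q, inner_zero_left]
  · rw [inner_firstOp, costFun_apply, ← add_assoc, ← inner_add_left, add_comm c, h.dual_φ,
      inner_zero_left, zero_add, Prod.snd_sub, inner_sub_right, real_inner_comm z β, h.compl,
      sub_zero]
    exact inner_nonneg_of_mem_coneQ _ h.β_mem _ hu.2

/-- The variational inequality only tests directions in `rgeAdj n`. It still forces the full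
equation for `φ`, because `hc` places the left-hand side of that equation in the same subspace. -/
theorem isRestrictedKKT_of_isSaddle {c φ : CSpace n} {z : KSpace n} {q α : SSpace n} {β : KSpace n}
    (hc : c ∈ rgeAdj n)
    (h : IsSaddle (feasSet n) (costFun c) (firstOp n) (secondOp n) (rhsVec n) (φ, z) q
      (WithLp.toLp 2 (α, β))) : IsRestrictedKKT n c φ z q α β := by
  have hres := h.feasible
  rw [residual_eq] at hres
  have hres' := congrArg WithLp.ofLp hres
  obtain ⟨hφ, hz⟩ := h.mem
  have hvar : ∀ φ' ∈ rgeAdj n, ∀ z' ∈ coneQ n,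
      0 ≤ inner ℝ (LinearMap.adjoint (gradOp n) α + c) (φ' - φ) + inner ℝ β (z' - z) := by
    intro φ' hφ' z' hz'
    have h1 := h.variational (φ', z') ⟨hφ', hz'⟩
    rw [inner_firstOp, costFun_apply, ← add_assoc, ← inner_add_left, add_comm c] at h1
    exact h1
  -- Complementarity follows by testing the two points `0` and `2 • z` on the ray through `z`.
  have h0 : inner ℝ β z = 0 := by
    have h1 := hvar φ hφ 0 zero_mem_coneQ
    have h2 := hvar φ hφ ((2 : ℝ) • z) (smul_mem_coneQ 2 zero_le_two z hz)
    rw [sub_self, inner_zero_right, zero_add] at h1 h2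
    rw [two_smul, add_sub_cancel_right] at h2
    rw [zero_sub, inner_neg_right] at h1
    linarith
  refine ⟨⟨congrArg Prod.fst hres', congrArg Prod.snd hres', ?_, ?_, hz,
    mem_coneQ_of_inner_nonneg fun w hw => ?_, by rw [real_inner_comm]; exact h0⟩, hφ⟩
  · have hmem : LinearMap.adjoint (gradOp n) α + c ∈ rgeAdj n :=
      (rgeAdj n).add_mem ⟨α, rfl⟩ hc
    have h1 := hvar (φ - (LinearMap.adjoint (gradOp n) α + c)) ((rgeAdj n).sub_mem hφ hmem) z hz
    rw [sub_self, inner_zero_right, add_zero, sub_sub_cancel_left, inner_neg_right] at h1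
    have h2 := real_inner_self_nonneg (x := LinearMap.adjoint (gradOp n) α + c)
    exact (inner_self_eq_zero (𝕜 := ℝ)).1 (le_antisymm (by linarith) h2)
  · have h1 := h.normal (α + LinearMap.adjoint (BF n) β)
    rw [inner_secondOp] at h1
    exact inner_self_eq_zero.1 h1
  · have h1 := hvar φ hφ w hw
    rw [sub_self, inner_zero_right, zero_add, inner_sub_right, h0, sub_zero] at h1
    exact h1

/-- The augmented Lagrangian on the cone. -/
noncomputable def augReal (n : Fin (D + 1) → ℕ) (c : CSpace n) (σ : ℝ)
    (u : CSpace n × KSpace n) (q : SSpace n) (l : WithLp 2 (SSpace n × KSpace n)) : ℝ :=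
  costFun c u + inner ℝ (firstOp n u - secondOp n q - rhsVec n) l
    + σ / 2 * ‖firstOp n u - secondOp n q - rhsVec n‖ ^ 2

theorem augLagrangian_eq (c : CSpace n) (σ : ℝ) (φ : CSpace n) (z : KSpace n) (q α : SSpace n)
    (β : KSpace n) : augLagrangian n c σ φ z q α β
      = (augReal n c σ (φ, z) q (WithLp.toLp 2 (α, β)) : EReal) + indQ n z := by
  unfold augLagrangian augReal
  rw [residual_eq, WithLp.prod_norm_sq_eq_of_L2, WithLp.prod_inner_apply, costFun_apply]
  congr 2
  change _ = _ + σ / 2 * (‖gradOp n φ - q‖ ^ 2 + ‖z - BF n q - shiftVec n‖ ^ 2)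
  rw [mul_add, ← add_assoc, ← add_assoc]

theorem augReal_eq (c : CSpace n) (σ : ℝ) (u : CSpace n × KSpace n) (q : SSpace n)
    (l : WithLp 2 (SSpace n × KSpace n)) : augReal n c σ u q l
      = costFun c u + inner ℝ (firstOp n u - (secondOp n q + rhsVec n)) l
        + σ / 2 * ‖firstOp n u - (secondOp n q + rhsVec n)‖ ^ 2 := by
  rw [← sub_sub]; rfl

theorem augLagrangian_of_mem (c : CSpace n) (σ : ℝ) (φ : CSpace n) {z : KSpace n} (q α : SSpace n)
    (β : KSpace n) (hz : z ∈ coneQ n) : augLagrangian n c σ φ z q α β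
      = (augReal n c σ (φ, z) q (WithLp.toLp 2 (α, β)) : EReal) := by
  rw [augLagrangian_eq, indQ, if_pos hz, add_zero]

theorem augLagrangian_of_notMem (c : CSpace n) (σ : ℝ) (φ : CSpace n) {z : KSpace n}
    (q α : SSpace n) (β : KSpace n) (hz : z ∉ coneQ n) : augLagrangian n c σ φ z q α β = ⊤ := by
  rw [augLagrangian_eq, indQ, if_neg hz, EReal.coe_add_top]

/-- A minimizer has finite value, since the origin is a competitor with finite value. -/
theorem IsALMSequence.mem_coneQ {c : CSpace n} {σ τ : ℝ} {q₀ α₀ : SSpace n} {β₀ : KSpace n}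
    {φ : ℕ → CSpace n} {z : ℕ → KSpace n} {q α : ℕ → SSpace n} {β : ℕ → KSpace n}
    (h : IsALMSequence n c σ τ q₀ α₀ β₀ φ z q α β) (k : ℕ) : z (k + 1) ∈ coneQ n := by
  by_contra hz
  have h1 := h.step_φz_min k 0 (rgeAdj n).zero_mem 0
  rw [augLagrangian_of_notMem _ _ _ _ _ _ hz, augLagrangian_of_mem _ _ _ _ _ _ zero_mem_coneQ,
    top_le_iff] at h1
  exact EReal.coe_ne_top _ h1

theorem IsALMSequence.variational {c : CSpace n} {σ τ : ℝ} {q₀ α₀ : SSpace n} {β₀ : KSpace n}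
    {φ : ℕ → CSpace n} {z : ℕ → KSpace n} {q α : ℕ → SSpace n} {β : ℕ → KSpace n}
    (h : IsALMSequence n c σ τ q₀ α₀ β₀ φ z q α β) (k : ℕ) (u : CSpace n × KSpace n)
    (hu : u ∈ feasSet n) :
    0 ≤ costFun c (u - (φ (k + 1), z (k + 1))) +
      inner ℝ (WithLp.toLp 2 (α k, β k)
        + σ • (firstOp n (φ (k + 1), z (k + 1)) - secondOp n (q k) - rhsVec n))
        (firstOp n (u - (φ (k + 1), z (k + 1)))) := by
  have hmin : ∀ u' ∈ feasSet n, augReal n c σ (φ (k + 1), z (k + 1)) (q k)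
      (WithLp.toLp 2 (α k, β k)) ≤ augReal n c σ u' (q k) (WithLp.toLp 2 (α k, β k)) := by
    rintro ⟨φ', z'⟩ ⟨hφ', hz'⟩
    have h2 := h.step_φz_min k φ' hφ' z'
    rwa [augLagrangian_of_mem _ _ _ _ _ _ (h.mem_coneQ k),
      augLagrangian_of_mem _ _ _ _ _ _ hz', EReal.coe_le_coe_iff] at h2
  simp only [augReal_eq] at hmin
  generalize (WithLp.toLp 2 (α k, β k) : WithLp 2 (SSpace n × KSpace n)) = l at hmin ⊢
  have hmem : (φ (k + 1), z (k + 1)) ∈ feasSet n := ⟨h.step_φz_mem k, h.mem_coneQ k⟩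
  generalize (φ (k + 1), z (k + 1)) = u₀ at hmin hmem ⊢
  generalize hw : secondOp n (q k) + rhsVec n = w at hmin
  rw [sub_sub, hw]
  have h1 := variational_of_min (C := feasSet n) (u := u₀) (σ := σ) convex_feasSet (firstOp n)
    (costFun c) l w hmem
  exact h1 hmin u hu

theorem IsALMSequence.normal {c : CSpace n} {σ τ : ℝ} {q₀ α₀ : SSpace n} {β₀ : KSpace n}
    {φ : ℕ → CSpace n} {z : ℕ → KSpace n} {q α : ℕ → SSpace n} {β : ℕ → KSpace n}
    (h : IsALMSequence n c σ τ q₀ α₀ β₀ φ z q α β) (k : ℕ) (v : SSpace n) :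
    inner ℝ (WithLp.toLp 2 (α k, β k)
      + σ • (firstOp n (φ (k + 1), z (k + 1)) - secondOp n (q (k + 1)) - rhsVec n))
      (secondOp n v) = 0 := by
  have hmin : ∀ q', augReal n c σ (φ (k + 1), z (k + 1)) (q (k + 1))
      (WithLp.toLp 2 (α k, β k))
      ≤ augReal n c σ (φ (k + 1), z (k + 1)) q' (WithLp.toLp 2 (α k, β k)) := fun q' => by
    have h2 := h.step_q_min k q'
    rwa [augLagrangian_of_mem _ _ _ _ _ _ (h.mem_coneQ k),
      augLagrangian_of_mem _ _ _ _ _ _ (h.mem_coneQ k), EReal.coe_le_coe_iff] at h2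
  simp only [augReal] at hmin
  generalize (WithLp.toLp 2 (α k, β k) : WithLp 2 (SSpace n × KSpace n)) = l at hmin ⊢
  generalize firstOp n (φ (k + 1), z (k + 1)) = x at hmin ⊢
  have e : ∀ q', x - secondOp n q' - rhsVec n = (-secondOp n) q' - (rhsVec n - x) := fun q' => by
    rw [LinearMap.neg_apply]; abel
  simp only [e] at hmin
  have h1 := variational_of_min convex_univ (-secondOp n) 0 l (rhsVec n - x) (σ := σ)
    (Set.mem_univ (q (k + 1))) fun q' _ => by
      have := hmin q'
      simp only [LinearMap.zero_apply]
      linarith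
  rw [← e] at h1
  -- Without constraints both directions `v` and `-v` are admissible, so the inequality becomes an
  -- equation.
  have h2 := h1 (q (k + 1) + v) (Set.mem_univ _)
  have h3 := h1 (q (k + 1) - v) (Set.mem_univ _)
  rw [add_sub_cancel_left, LinearMap.zero_apply, zero_add, LinearMap.neg_apply,
    inner_neg_right] at h2
  rw [sub_sub_cancel_left, LinearMap.zero_apply, zero_add, LinearMap.neg_apply, map_neg,
    neg_neg] at h3
  linarith

theorem IsALMSequence.isADMM {c : CSpace n} {σ τ : ℝ} {q₀ α₀ : SSpace n} {β₀ : KSpace n}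
    {φ : ℕ → CSpace n} {z : ℕ → KSpace n} {q α : ℕ → SSpace n} {β : ℕ → KSpace n}
    (h : IsALMSequence n c σ τ q₀ α₀ β₀ φ z q α β) :
    IsADMM (feasSet n) (costFun c) (firstOp n) (secondOp n) (rhsVec n) σ τ
      (fun k => (φ k, z k)) q (fun k => WithLp.toLp 2 (α k, β k)) where
  mem k := ⟨h.step_φz_mem k, h.mem_coneQ k⟩
  variational := h.variational
  normal := h.normal
  step k := by
    rw [residual_eq, ← WithLp.toLp_smul, ← WithLp.toLp_add, h.step_α, h.step_β]
    rfl

theorem exists_first_step (c : CSpace n) {σ : ℝ} (hσ : 0 < σ) (q α : SSpace n) (β : KSpace n) :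
    ∃ φ ∈ rgeAdj n, ∃ z ∈ coneQ n, ∀ φ' ∈ rgeAdj n, ∀ z' : KSpace n,
      augLagrangian n c σ φ z q α β ≤ augLagrangian n c σ φ' z' q α β := by
  set l : WithLp 2 (SSpace n × KSpace n) := WithLp.toLp 2 (α, β) with hl
  obtain ⟨m, hm⟩ := exists_norm_le_firstOp (n := n)
  obtain ⟨⟨φ, z⟩, ⟨hφ, hz⟩, hmin⟩ := exists_min_linear_add_sq isClosed_feasSet
    (⟨0, ⟨(rgeAdj n).zero_mem, zero_mem_coneQ⟩⟩ : (feasSet n).Nonempty) (firstOp n) hm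
    (costFun c + innerₛₗ ℝ l ∘ₗ firstOp n) (secondOp n q + rhsVec n) hσ
  refine ⟨φ, hφ, z, hz, fun φ' hφ' z' => ?_⟩
  by_cases hz' : z' ∈ coneQ n
  · rw [augLagrangian_of_mem _ _ _ _ _ _ hz, augLagrangian_of_mem _ _ _ _ _ _ hz',
      EReal.coe_le_coe_iff]
    have h1 := hmin (φ', z') ⟨hφ', hz'⟩
    simp only [LinearMap.add_apply, LinearMap.comp_apply, innerₛₗ_apply_apply] at h1
    rw [augReal_eq, augReal_eq, inner_sub_left, inner_sub_left]
    rw [real_inner_comm l (firstOp n (φ, z)), real_inner_comm l (firstOp n (φ', z'))]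
    linarith
  · rw [augLagrangian_of_notMem _ _ _ _ _ _ hz']
    exact le_top

theorem exists_second_step (c : CSpace n) {σ : ℝ} (hσ : 0 < σ) (φ : CSpace n) {z : KSpace n}
    (hz : z ∈ coneQ n) (α : SSpace n) (β : KSpace n) :
    ∃ q, ∀ q', augLagrangian n c σ φ z q α β ≤ augLagrangian n c σ φ z q' α β := by
  set l : WithLp 2 (SSpace n × KSpace n) := WithLp.toLp 2 (α, β) with hl
  obtain ⟨q, -, hmin⟩ := exists_min_linear_add_sq isClosed_univ Set.univ_nonempty (secondOp n)
    (fun u _ u' _ => norm_le_secondOp (u - u')) (-(innerₛₗ ℝ l ∘ₗ secondOp n))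
    (firstOp n (φ, z) - rhsVec n) hσ
  refine ⟨q, fun q' => ?_⟩
  rw [augLagrangian_of_mem _ _ _ _ _ _ hz, augLagrangian_of_mem _ _ _ _ _ _ hz,
    EReal.coe_le_coe_iff]
  have h1 := hmin q' (Set.mem_univ _)
  have e : ∀ q', ‖secondOp n q' - (firstOp n (φ, z) - rhsVec n)‖
      = ‖firstOp n (φ, z) - secondOp n q' - rhsVec n‖ := fun q' => by
    rw [← norm_neg]; congr 1; abel
  rw [e, e] at h1
  simp only [LinearMap.neg_apply, LinearMap.comp_apply, innerₛₗ_apply_apply] at h1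
  simp only [augReal]
  rw [inner_sub_left _ (rhsVec n), inner_sub_left _ (rhsVec n), inner_sub_left, inner_sub_left,
    real_inner_comm l (secondOp n q), real_inner_comm l (secondOp n q')]
  linarith

/-- The algorithm can be carried out. -/
theorem exists_isALMSequence (c : CSpace n) {σ : ℝ} (hσ : 0 < σ) (τ : ℝ) (q₀ α₀ : SSpace n)
    (β₀ : KSpace n) : ∃ φ z q α β, IsALMSequence n c σ τ q₀ α₀ β₀ φ z q α β := by
  choose Φ hΦ Z hZ hmin using fun q α β => exists_first_step (n := n) c hσ q α β
  choose G hG using fun q α β => exists_second_step (n := n) c hσ (Φ q α β) (hZ q α β) α β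
  let next : CSpace n × KSpace n × SSpace n × SSpace n × KSpace n →
      CSpace n × KSpace n × SSpace n × SSpace n × KSpace n := fun s =>
    let q := s.2.2.1
    let α := s.2.2.2.1
    let β := s.2.2.2.2
    (Φ q α β, Z q α β, G q α β, α + (τ * σ) • (gradOp n (Φ q α β) - G q α β),
      β + (τ * σ) • (Z q α β - BF n (G q α β) - shiftVec n))
  -- The two leading zeros are placeholders for `φ 0` and `z 0`, which no step reads.
  let s : ℕ → CSpace n × KSpace n × SSpace n × SSpace n × KSpace n := fun k =>
    next^[k] (0, 0, q₀, α₀, β₀)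
  have hs : ∀ k, s (k + 1) = next (s k) := fun k => Function.iterate_succ_apply' _ _ _
  refine ⟨fun k => (s k).1, fun k => (s k).2.1, fun k => (s k).2.2.1, fun k => (s k).2.2.2.1,
    fun k => (s k).2.2.2.2, rfl, rfl, rfl, fun k => ?_, fun k => ?_, fun k => ?_, fun k => ?_,
    fun k => ?_⟩
  · simp only [hs]; exact hΦ _ _ _
  · simp only [hs]; exact hmin _ _ _
  · simp only [hs]; exact hG _ _ _
  · simp only [hs, next]
  · simp only [hs, next]

end DiscreteDOT

theorem theorem4p1 {D : ℕ} (n : Fin (D + 1) → ℕ) (hn : ∀ d, 0 < n d)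
    (ρ₀ ρ₁ : Measure (DiscreteDOT.Cube D)) [IsFiniteMeasure ρ₀] [IsFiniteMeasure ρ₁]
    (hρ₀ : ρ₀ ≠ 0) (hρ₁ : ρ₁ ≠ 0)
    (σ τ : ℝ) (hσ : 0 < σ) (hτ : τ ∈ Set.Ioo (0 : ℝ) 2)
    (q₀ α₀ : DiscreteDOT.SSpace n) (β₀ : DiscreteDOT.KSpace n) (hβ₀ : β₀ ∈ DiscreteDOT.coneQ n) :
    (∃ (φ : ℕ → DiscreteDOT.CSpace n) (z : ℕ → DiscreteDOT.KSpace n)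
      (q α : ℕ → DiscreteDOT.SSpace n) (β : ℕ → DiscreteDOT.KSpace n),
      DiscreteDOT.IsALMSequence n (DiscreteDOT.costVec n ρ₀ ρ₁) σ τ q₀ α₀ β₀ φ z q α β) ∧
    ∀ (φ : ℕ → DiscreteDOT.CSpace n) (z : ℕ → DiscreteDOT.KSpace n)
      (q α : ℕ → DiscreteDOT.SSpace n) (β : ℕ → DiscreteDOT.KSpace n),
      DiscreteDOT.IsALMSequence n (DiscreteDOT.costVec n ρ₀ ρ₁) σ τ q₀ α₀ β₀ φ z q α β →
      ∃ (φs : DiscreteDOT.CSpace n) (zs : DiscreteDOT.KSpace n)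
        (qs αs : DiscreteDOT.SSpace n) (βs : DiscreteDOT.KSpace n),
        DiscreteDOT.IsRestrictedKKT n (DiscreteDOT.costVec n ρ₀ ρ₁) φs zs qs αs βs ∧
        DiscreteDOT.IsKKT n (DiscreteDOT.costVec n ρ₀ ρ₁) φs zs qs αs βs ∧
        Tendsto φ atTop (𝓝 φs) ∧ Tendsto z atTop (𝓝 zs) ∧ Tendsto q atTop (𝓝 qs) ∧
        Tendsto α atTop (𝓝 αs) ∧ Tendsto β atTop (𝓝 βs) := by

  refine ⟨DiscreteDOT.exists_isALMSequence _ hσ τ q₀ α₀ β₀, fun φ z q α β h => ?_⟩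
  obtain ⟨φ', z', q', α', β', hkkt⟩ := DiscreteDOT.exists_isRestrictedKKT hn ρ₀ ρ₁ hρ₀ hρ₁
  obtain ⟨m, hm⟩ := DiscreteDOT.exists_norm_le_firstOp (n := n)
  obtain ⟨⟨φs, zs⟩, qs, ls, hsad, hu, hq, hl⟩ := h.isADMM.tendsto hσ hτ
    DiscreteDOT.isClosed_feasSet hm DiscreteDOT.norm_le_secondOp hkkt.isSaddle
  -- The dual equation of the KKT point already found exhibits the cost vector in the range of the
  -- adjoint.
  have hc : DiscreteDOT.costVec n ρ₀ ρ₁ ∈ DiscreteDOT.rgeAdj n :=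
    ⟨-α', by rw [map_neg]; exact neg_eq_of_add_eq_zero_right hkkt.dual_φ⟩
  have hl' := ((WithLp.prod_continuous_ofLp 2 _ _).tendsto ls).comp hl
  have hfinal := DiscreteDOT.isRestrictedKKT_of_isSaddle hc (α := ls.fst) (β := ls.snd) hsad
  exact ⟨φs, zs, qs, ls.fst, ls.snd, hfinal, hfinal.toIsKKT, hu.fst_nhds, hu.snd_nhds, hq,
    hl'.fst_nhds, hl'.snd_nhds⟩
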